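/- Fix $-1<w<1$. For $\mathbf S=(\Sigma_+,\bar\Sigma,\tilde\Sigma^2,\check\Sigma^2,\Omega_k,v^2)\in\mathbb R^6$ (the squares $\tilde\Sigma^2,\check\Sigma^2,v^2$ are treated as independent variables) put $$\Sigma^2=\Sigma_+^2+\bar\Sigma^2+\tilde\Sigma^2+\check\Sigma^2,\quad \Omega=1-\Sigma^2-\Omega_k,\quad G_\pm=1\pm w v^2,\quad q=2\Sigma^2+\tfrac12G_+^{-1}[1+3w+(1-w)v^2]\Omega .$$ The tilted Bianchi type II perfect fluid models with equation of state $p=w\rho$ are described by the system ($'=d/d\tau$) $$\begin{aligned} \Sigma_+'&=-(2-q)\Sigma_+-3\check\Sigma^2+4\Omega_k+\tfrac12(1+w)G_+^{-1}v^2\Omega,\\ \bar\Sigma'&=-(2-q)\bar\Sigma-2\sqrt3\,\tilde\Sigma^2+\sqrt3\,\check\Sigma^2+\tfrac{\sqrt3}{2}(1+w)G_+^{-1}v^2\Omega,\\ (\tilde\Sigma^2)'&=-2(2-q-2\sqrt3\,\bar\Sigma)\tilde\Sigma^2,\\ (\check\Sigma^2)'&=-2(2-q-3\Sigma_++\sqrt3\,\bar\Sigma)\check\Sigma^2,\\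 \Omega_k'&=2(q-4\Sigma_+)\Omega_k,\\ (v^2)'&=2G_-^{-1}(1-v^2)(3w-1-\Sigma_+-\sqrt3\,\bar\Sigma)v^2, \end{aligned}$$ with the constraint $4\check\Sigma^2\Omega_k-(1+w)^2G_+^{-2}v^2\Omega^2=0$. Let $\mathcal S_{\mathrm{Gen}}$ be the set of all $\mathbf S$ that satisfy the constraint, $\tilde\Sigma^2,\check\Sigma^2,\Omega_k,v^2,\Omega\ge0$, $v^2\le1$ and $(1-v^2)\,v^2\,\tilde\Sigma^2\,\check\Sigma^2\,\Omega\,\Omega_k\neq0$. **Theorem.** Let $\mathbf x\in\mathcal S_{\mathrm{Gen}}$. There is a solution of the system on $[0,\infty)$ starting at $\mathbf x$, and every such solution stays in $\mathcal S_{\mathrm{Gen}}$ and has the following $\omega$-limit set $\omega(\mathbf x)$: - $\omega(\mathbf x)=\{\mathrm F\}$ if $-1<w\le-\frac13$, where $\mathrm F=(0,0,0,0,0,0)$ (flat Friedmann); - $\omega(\mathbf x)=\{\mathrm{CS}\}$ if $-\frac13<w\le\frac37$, where $\mathrm{CS}=\left(\frac{3w+1}{8},0,0,0,\frac{3}{64}(3w+1)(1-w),0\right)$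 (Collins–Stewart); - $\omega(\mathbf x)=\{\mathrm H\}$ if $\frac37<w<\frac59$, where $\mathrm H=\left(\frac{3w+1}{8},\frac{\sqrt3}{8}(7w-3),0,\frac{3(1-w)(11w+1)(7w-3)}{16(17w-1)},\frac{3(1-w)(5w+1)(3w-1)}{4(17w-1)},\frac{(3w-1)(7w-3)}{(11w+1)(5w+1)}\right)$ (Hewitt); - $\omega(\mathbf x)=\{\mathrm{HL}(b)\}$ for some $b\in(0,1)$ depending on $\mathbf x$ if $w=\frac59$, where $\mathrm{HL}(b)=\left(\frac13,\frac{1}{3\sqrt3},\frac{4}{27}b,\frac{4(4b+1)(8-3b)}{513},\frac{(2b+1)(17-8b)}{171},\frac{3(4b+1)(2b+1)}{(17-8b)(8-3b)}\right)$, that is, the $\omega$-limit set is a single point of the line $\mathrm{HL}=\{\mathrm{HL}(b):0<b<1\}$ of fixed points; - $\omega(\mathbf x)=\{\mathrm{Het}\}$ if $\frac59<w<1$, where $\mathrm{Het}=\left(\frac13,\frac{1}{3\sqrt3},\frac{4}{27},\frac{100}{513},\frac{3}{19},1\right)$ (extremely tilted). -/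

import Mathlib

namespace TiltedBianchiII

noncomputable section

/-- State vectors `(Σ₊, Σ̄, Σ̃², Σ̌², Ω_k, v²)`.  The squares are themselves the coordinates.
Only the topology and the differentiable structure of the space are used. -/
abbrev State : Type := Fin 6 → ℝ

/-- `Σ₊` -/
abbrev sigPlus (S : State) : ℝ := S 0
/-- `Σ̄` -/
abbrev sigBar (S : State) : ℝ := S 1
/-- `Σ̃²` -/
abbrev sigTildeSq (S : State) : ℝ := S 2
/-- `Σ̌²` -/
abbrev sigCheckSq (S : State) : ℝ := S 3
/-- `Ω_k` -/
abbrev omK (S : State) : ℝ := S 4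
/-- `v²` -/
abbrev vSq (S : State) : ℝ := S 5

/-- `Σ² = Σ₊² + Σ̄² + Σ̃² + Σ̌²` -/
def sigSq (S : State) : ℝ := sigPlus S ^ 2 + sigBar S ^ 2 + sigTildeSq S + sigCheckSq S

/-- The density parameter, `Ω = 1 - Σ² - Ω_k` (Gauss constraint). -/
def om (S : State) : ℝ := 1 - sigSq S - omK S

/-- `G₊ = 1 + w v²` -/
def gPlus (w : ℝ) (S : State) : ℝ := 1 + w * vSq S

/-- `G₋ = 1 - w v²` -/
def gMinus (w : ℝ) (S : State) : ℝ := 1 - w * vSq S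

/-- The deceleration parameter `q`. -/
def decel (w : ℝ) (S : State) : ℝ :=
  2 * sigSq S + (1 / 2) * (gPlus w S)⁻¹ * (1 + 3 * w + (1 - w) * vSq S) * om S

/-- The right-hand side of the evolution equations (derivative with respect to `τ`). -/
def field (w : ℝ) (S : State) : State :=
  ![-(2 - decel w S) * sigPlus S - 3 * sigCheckSq S + 4 * omK S
      + (1 / 2) * (1 + w) * (gPlus w S)⁻¹ * vSq S * om S,
    -(2 - decel w S) * sigBar S - 2 * √3 * sigTildeSq S + √3 * sigCheckSq S
      + (√3 / 2) * (1 + w) * (gPlus w S)⁻¹ * vSq S * om S,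
    -2 * (2 - decel w S - 2 * √3 * sigBar S) * sigTildeSq S,
    -2 * (2 - decel w S - 3 * sigPlus S + √3 * sigBar S) * sigCheckSq S,
    2 * (decel w S - 4 * sigPlus S) * omK S,
    2 * (gMinus w S)⁻¹ * (1 - vSq S) * (3 * w - 1 - sigPlus S - √3 * sigBar S) * vSq S]

/-- The Codazzi constraint function `f(S)`. -/
def codazzi (w : ℝ) (S : State) : ℝ :=
  4 * sigCheckSq S * omK S - (1 + w) ^ 2 * (gPlus w S)⁻¹ ^ 2 * vSq S * om S ^ 2

/-- The state space: the constraint `f(S) = 0` holds, the coordinates that stand for squares and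
`Ω_k` are nonnegative, `v² ≤ 1`, and `Ω ≥ 0`. -/
def stateSpace (w : ℝ) : Set State :=
  {S | codazzi w S = 0 ∧ 0 ≤ sigTildeSq S ∧ 0 ≤ sigCheckSq S ∧ 0 ≤ omK S ∧
    0 ≤ vSq S ∧ vSq S ≤ 1 ∧ 0 ≤ om S}

/-- The general tilted type II state space `S_Gen`. -/
def sGen (w : ℝ) : Set State :=
  {S | S ∈ stateSpace w ∧
    (1 - vSq S) * vSq S * sigTildeSq S * sigCheckSq S * om S * omK S ≠ 0}

/-- `γ` is a solution of the evolution equations for all `τ ≥ 0` with initial state `x`;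
values of `γ` at `τ < 0` are irrelevant. -/
def IsFutureOrbit (w : ℝ) (x : State) (γ : ℝ → State) : Prop :=
  γ 0 = x ∧ IsIntegralCurveOn γ (fun _ => field w) (Set.Ici 0)

/-- The ω-limit set of a curve: all limits of `γ (τₙ)` for sequences `τₙ → ∞`. -/
def omegaSet (γ : ℝ → State) : Set State :=
  omegaLimit Filter.atTop (fun (τ : ℝ) (c : ℝ → State) => c τ) {γ}

/-- The flat Friedmann point `F`. -/
def ptF : State := ![0, 0, 0, 0, 0, 0]

/-- The Collins–Stewart point `CS`. -/
def ptCS (w : ℝ) : State :=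
  ![(3 * w + 1) / 8, 0, 0, 0, 3 / 64 * (3 * w + 1) * (1 - w), 0]

/-- Hewitt's point `H`. -/
def ptH (w : ℝ) : State :=
  ![(3 * w + 1) / 8,
    √3 / 8 * (7 * w - 3),
    0,
    3 * (1 - w) * (11 * w + 1) * (7 * w - 3) / (16 * (17 * w - 1)),
    3 * (1 - w) * (5 * w + 1) * (3 * w - 1) / (4 * (17 * w - 1)),
    (3 * w - 1) * (7 * w - 3) / ((11 * w + 1) * (5 * w + 1))]

/-- The point with parameter `b` on the line of fixed points `HL`. -/
def ptHL (b : ℝ) : State :=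
  ![1 / 3,
    1 / (3 * √3),
    4 / 27 * b,
    4 * (4 * b + 1) * (8 - 3 * b) / 513,
    (2 * b + 1) * (17 - 8 * b) / 171,
    3 * (4 * b + 1) * (2 * b + 1) / ((17 - 8 * b) * (8 - 3 * b))]

/-- The extremely tilted point `Het`. -/
def ptHet : State := ![1 / 3, 1 / (3 * √3), 4 / 27, 100 / 513, 3 / 19, 1]

end

end TiltedBianchiII

/-! The state space is compact. Each of `Σ̃²`, `Σ̌²`, `Ω_k`, `v²`, `1 - v²`, `Ω` and the constraint
function solves a linear equation `y' = g y` with `g` bounded. The six positive quantities therefore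
never reach zero and the constraint function stays zero, so orbits remain in `sGen` for all time.

The asymptotics come from monotone functions: a product of powers of `Σ̃²`, `Σ̌²`, `Ω_k` and the
matter density `Ω (1 - v²)^((1-w)/2) / G₊`, divided by a power of a linear form `1 - ⟨z₀, z⟩`, where
`z = (Σ₊, Σ̄)` and `z₀` is its value at the expected limit. The Gauss identity turns the logarithmic
derivative times the linear form into a positive definite form in `z - z₀` plus a remainder that is
nonnegative in the relevant range of `w` (`friedmann_identity` to `extreme_identity`). The
thresholds in `w` are the values where a remainder coefficient or an exponent changes sign.

The logarithm is bounded above, so it converges, and Barbalat's lemma sends its derivative to zero.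
At every cluster point `z = z₀`, the remainder vanishes, and the factors with positive exponent are
nonzero because the logarithm never falls below its initial value. Since `Σ₊` and `Σ̄` now converge,
Barbalat's lemma also makes their derivatives vanish there (`IsFutureOrbit.of_weights`). With the
Gauss and Codazzi relations this leaves a single point.

At `w = 5/9` it leaves a line of fixed points. There two monotone functions exist at once, and a
combination of their limits is an injective function of the position on the line. -/

namespace TiltedBianchiII

open Filter Set Topology

/-! ### Analysis: global existence, Barbalat's lemma, cluster points, linear equations -/

/-- A bounded, globally Lipschitz vector field has an integral curve on `[0, ∞)` through each
point. -/
theorem exists_isIntegralCurveOn_Ici {E : Type*} [NormedAddCommGroup E] [NormedSpace ℝ E]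
    [CompleteSpace E] {F : E → E} {K M : NNReal} (hK : LipschitzWith K F) (hM : ∀ y, ‖F y‖ ≤ M)
    (x : E) : ∃ γ : ℝ → E, γ 0 = x ∧ IsIntegralCurveOn γ (fun _ => F) (Ici 0) := by
  have key : ∀ n : ℕ, ∃ γ : ℝ → E, γ 0 = x ∧
      ∀ t ∈ Icc (0 : ℝ) (n + 1), HasDerivWithinAt γ (F (γ t)) (Icc 0 ((n : ℝ) + 1)) t := by
    intro n
    have hn : (0 : ℝ) ∈ Icc (0 : ℝ) (n + 1) := ⟨le_rfl, by positivity⟩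
    -- A curve of speed at most `M` stays within `M * (n + 1)` of `x` up to time `n + 1`, so one
    -- Picard–Lindelöf step covers the whole interval.
    have hpl : IsPicardLindelof (fun _ : ℝ => F) (tmin := 0) (tmax := (n : ℝ) + 1)
        ⟨0, hn⟩ x (M * (n + 1)) 0 M K :=
      { lipschitzOnWith := fun _ _ => hK.lipschitzOnWith
        continuousOn := fun _ _ => continuousOn_const
        norm_le := fun _ _ y _ => hM y
        mul_max_le := by
          have : max ((n : ℝ) + 1 - 0) (0 - 0) = n + 1 := by
            rw [sub_zero, sub_zero]; exact max_eq_left hn.2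
          simp only [this]
          push_cast
          simp }
    exact hpl.exists_eq_forall_mem_Icc_hasDerivWithinAt₀
  choose γ h0 hγ using key
  have huniq : ∀ m n : ℕ, m ≤ n → EqOn (γ m) (γ n) (Icc 0 ((m : ℝ) + 1)) := by
    intro m n hmn
    have hmn' : (m : ℝ) ≤ n := by exact_mod_cast hmn
    have hsub : Icc (0 : ℝ) (m + 1) ⊆ Icc (0 : ℝ) (n + 1) := Icc_subset_Icc_right (by linarith)
    have hr : ∀ k : ℕ, ∀ t ∈ Ico (0 : ℝ) (k + 1), HasDerivWithinAt (γ k) (F (γ k t)) (Ici t) t := by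
      intro k t ht
      exact (hγ k t ⟨ht.1, ht.2.le⟩).mono_of_mem_nhdsWithin
        (mem_of_superset (Icc_mem_nhdsGE ht.2) (Icc_subset_Icc_left ht.1))
    refine ODE_solution_unique (v := fun _ => F) (K := K) (fun _ => hK)
      (fun t ht => (hγ m t ht).continuousWithinAt) (hr m)
      (fun t ht => ((hγ n t (hsub ht)).mono hsub).continuousWithinAt)
      (fun t ht => hr n t ⟨ht.1, ht.2.trans_le (by linarith)⟩) ?_
    rw [h0, h0]
  -- The local solutions are glued along the integer part. Near `t` the glued curve is compared with
  -- the one of index `⌊t⌋₊ + 1`, which covers a full neighbourhood of `t` even where the integer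
  -- part jumps.
  refine ⟨fun t => γ ⌊t⌋₊ t, by simp [h0], fun t ht => ?_⟩
  set N := ⌊t⌋₊ + 1 with hN
  have htN : t < (N : ℝ) + 1 := by
    have := Nat.lt_floor_add_one t
    rw [hN]; push_cast; linarith
  have heq : ∀ s ∈ Ici (0 : ℝ) ∩ Iio ((N : ℝ)), γ ⌊s⌋₊ s = γ N s := by
    rintro s ⟨hs0, hs1⟩
    have hle : ⌊s⌋₊ ≤ N := (Nat.floor_lt hs0).2 hs1 |>.le
    exact huniq _ _ hle ⟨hs0, (Nat.lt_floor_add_one s).le⟩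
  have ht1 : t < (N : ℝ) := by
    have := Nat.lt_floor_add_one t
    rw [hN]; push_cast; linarith
  have hmem : Ici (0 : ℝ) ∩ Iio (N : ℝ) ∈ 𝓝[Ici 0] t :=
    inter_mem self_mem_nhdsWithin (mem_nhdsWithin_of_mem_nhds (Iio_mem_nhds ht1))
  have hd : HasDerivWithinAt (γ N) (F (γ N t)) (Ici 0) t :=
    (hγ N t ⟨ht, htN.le⟩).mono_of_mem_nhdsWithin
      (mem_of_superset hmem fun s hs => ⟨hs.1, (mem_Iio.1 hs.2).le.trans (by linarith)⟩)
  have e : γ ⌊t⌋₊ t = γ N t := heq t ⟨ht, ht1⟩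
  show HasDerivWithinAt _ (F (γ ⌊t⌋₊ t)) _ _
  rw [e]
  exact hd.congr_of_eventuallyEq (mem_of_superset hmem heq) e

/-- Barbalat's lemma: if `f` converges and its derivative is uniformly continuous on `[0, ∞)`, then
the derivative tends to `0`. -/
theorem tendsto_deriv_zero_of_tendsto {f g : ℝ → ℝ} {c : ℝ}
    (hf : ∀ t ∈ Ici (0 : ℝ), HasDerivWithinAt f (g t) (Ici 0) t)
    (hg : UniformContinuousOn g (Ici 0)) (hc : Tendsto f atTop (𝓝 c)) :
    Tendsto g atTop (𝓝 0) := by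
  rw [Metric.tendsto_atTop]
  intro ε hε
  obtain ⟨δ, hδ, hgδ⟩ := Metric.uniformContinuousOn_iff.1 hg (ε / 2) (by positivity)
  set η := δ / 2 with hη
  have hηpos : 0 < η := by positivity
  -- Two values of `f` within `ε η / 4` of `c` give a slope below `ε / 2` over a step of length `η`;
  -- uniform continuity of `g` costs another `ε / 2`.
  obtain ⟨N, hN⟩ := Metric.tendsto_atTop.1 hc (ε / 4 * η) (by positivity)
  refine ⟨max N 0, fun t ht => ?_⟩
  have ht0 : 0 ≤ t := (le_max_right _ _).trans ht
  have htN : N ≤ t := (le_max_left _ _).trans ht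
  obtain ⟨s, hs, hsd⟩ := exists_hasDerivAt_eq_slope f g (show t < t + η by linarith)
    (fun s hs => ((hf s (ht0.trans hs.1)).continuousWithinAt).mono
      fun r hr => ht0.trans hr.1)
    (fun s hs => (hf s (ht0.trans hs.1.le)).hasDerivAt (Ici_mem_nhds (ht0.trans_lt hs.1)))
  have h1 := hN t htN
  have h2 := hN (t + η) (by linarith)
  have h3 := hgδ s (ht0.trans hs.1.le) t ht0 (by
    rw [Real.dist_eq, abs_of_pos (by linarith [hs.1])]; linarith [hs.2])
  rw [add_sub_cancel_left, eq_div_iff hηpos.ne'] at hsd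
  rw [Real.dist_eq, abs_lt] at h1 h2 h3
  rw [Real.dist_eq, sub_zero]
  have h4 : |g s| < ε / 2 := by
    rw [abs_lt]
    constructor <;> by_contra! hcon
    · nlinarith
    · nlinarith
  rw [abs_lt] at h4 ⊢
  constructor <;> linarith [h4.1, h4.2, h3.1, h3.2]

/-- A function with nonnegative derivative that is bounded above on `[0, ∞)` converges. -/
theorem exists_tendsto_of_deriv_nonneg {f g : ℝ → ℝ} {B : ℝ}
    (hf : ∀ t ∈ Ici (0 : ℝ), HasDerivWithinAt f (g t) (Ici 0) t)
    (hg : ∀ t ∈ Ici (0 : ℝ), 0 ≤ g t) (hB : ∀ t ∈ Ici (0 : ℝ), f t ≤ B) :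
    MonotoneOn f (Ici 0) ∧ ∃ c, Tendsto f atTop (𝓝 c) := by
  have hmono : MonotoneOn f (Ici 0) := by
    refine monotoneOn_of_hasDerivWithinAt_nonneg (convex_Ici 0)
      (fun t ht => (hf t ht).continuousWithinAt) (f' := g) ?_ ?_
    · intro t ht
      exact (hf t (interior_subset ht)).mono interior_subset
    · intro t ht
      exact hg t (interior_subset ht)
  refine ⟨hmono, ?_⟩
  have hm : Monotone fun t => f (max t 0) := fun a b hab =>
    hmono (mem_Ici.2 (le_max_right _ _)) (mem_Ici.2 (le_max_right _ _)) (max_le_max_right 0 hab)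
  have hb : BddAbove (range fun t => f (max t 0)) :=
    ⟨B, by rintro _ ⟨t, rfl⟩; exact hB _ (mem_Ici.2 (le_max_right _ _))⟩
  refine ⟨_, (tendsto_atTop_ciSup hm hb).congr' ?_⟩
  filter_upwards [eventually_ge_atTop (0 : ℝ)] with t ht
  rw [max_eq_left ht]

/-- If a function takes the value `c` at all cluster points of a curve in a compact set, then it
tends to `c` along the curve. -/
theorem tendsto_of_forall_mapClusterPt {X : Type*} [TopologicalSpace X] {K : Set X}
    (hK : IsCompact K) {γ : ℝ → X} (hγ : ∀ t ∈ Ici (0 : ℝ), γ t ∈ K) {φ : X → ℝ} {c : ℝ}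
    (hφ : ContinuousOn φ K) (h : ∀ y ∈ K, MapClusterPt y atTop γ → φ y = c) :
    Tendsto (fun t => φ (γ t)) atTop (𝓝 c) := by
  rw [tendsto_iff_ultrafilter]
  intro u hu
  have hev : ∀ᶠ t in atTop, γ t ∈ K :=
    (eventually_ge_atTop (0 : ℝ)).mono fun t ht => hγ t ht
  have hKu : K ∈ u.map γ := hu hev
  obtain ⟨y, hy, hyu⟩ := hK.ultrafilter_le_nhds' (u.map γ) hKu
  have hcl : MapClusterPt y atTop γ :=
    (ClusterPt.of_le_nhds hyu).mono (Filter.map_mono hu)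
  rw [← h y hy hcl]
  exact (hφ y hy).tendsto.comp (le_inf hyu (le_principal_iff.2 hKu))

/-- The limit of a continuous function along a curve in a closed set is its value at every cluster
point. -/
theorem eq_of_mapClusterPt {X : Type*} [TopologicalSpace X] {K : Set X}
    (hK : IsClosed K) {γ : ℝ → X} (hγ : ∀ t ∈ Ici (0 : ℝ), γ t ∈ K) {φ : X → ℝ} {c : ℝ}
    (hφ : ContinuousOn φ K) (h : Tendsto (fun t => φ (γ t)) atTop (𝓝 c)) {y : X}
    (hy : MapClusterPt y atTop γ) : y ∈ K ∧ φ y = c := by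
  have hev : ∀ᶠ t in atTop, γ t ∈ K :=
    (eventually_ge_atTop (0 : ℝ)).mono fun t ht => hγ t ht
  obtain ⟨u, hu, hyu⟩ := mapClusterPt_iff_ultrafilter.1 hy
  have hKu : ∀ᶠ t in u, γ t ∈ K := hu hev
  have hyK : y ∈ K := hK.mem_of_tendsto hyu hKu
  refine ⟨hyK, tendsto_nhds_unique ((hφ y hyK).tendsto.comp ?_) (h.mono_left hu)⟩
  exact tendsto_nhdsWithin_iff.2 ⟨hyu, hKu⟩

/-- A positive solution of a linear equation with bounded coefficient on `[0, T)` is positive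
at `T`. -/
theorem pos_of_linear_deriv {y g : ℝ → ℝ} {T C : ℝ} (hT : 0 ≤ T)
    (hy : ContinuousOn y (Icc 0 T)) (hd : ∀ t ∈ Ioo 0 T, HasDerivAt y (g t * y t) t)
    (hg : ∀ t ∈ Ioo 0 T, -C ≤ g t) (hpos : ∀ t ∈ Ico 0 T, 0 < y t) (h0 : 0 < y 0) : 0 < y T := by
  have hm : MonotoneOn (fun t => y t * Real.exp (C * t)) (Icc 0 T) := by
    refine monotoneOn_of_hasDerivWithinAt_nonneg (convex_Icc 0 T)
      (f' := fun t => (g t + C) * y t * Real.exp (C * t))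
      (hy.mul (by fun_prop)) ?_ ?_
    · intro t ht
      rw [interior_Icc] at ht ⊢
      have h1 : HasDerivAt (fun t => Real.exp (C * t)) (Real.exp (C * t) * C) t := by
        simpa using ((hasDerivAt_id t).const_mul C).exp
      exact (((hd t ht).mul h1).congr_deriv (by ring)).hasDerivWithinAt
    · intro t ht
      rw [interior_Icc] at ht
      have := hpos t ⟨ht.1.le, ht.2⟩
      have := hg t ht
      have : 0 ≤ g t + C := by linarith
      positivity
  have := hm (left_mem_Icc.2 hT) (right_mem_Icc.2 hT) hT
  simp only [mul_zero, Real.exp_zero, mul_one] at this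
  have h2 : 0 < y T * Real.exp (C * T) := h0.trans_le this
  exact pos_of_mul_pos_left h2 (Real.exp_pos _).le

/-- A solution of a linear equation with bounded coefficient on `[0, T)` that vanishes at `0`
vanishes. -/
theorem eq_zero_of_linear_deriv {y g : ℝ → ℝ} {T C : ℝ}
    (hy : ContinuousOn y (Icc 0 T)) (hd : ∀ t ∈ Ioo 0 T, HasDerivAt y (g t * y t) t)
    (hg : ∀ t ∈ Ioo 0 T, g t ≤ C) (h0 : y 0 = 0) : ∀ t ∈ Icc 0 T, y t = 0 := by
  have hm : AntitoneOn (fun t => y t ^ 2 * Real.exp (-(2 * C) * t)) (Icc 0 T) := by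
    refine antitoneOn_of_hasDerivWithinAt_nonpos (convex_Icc 0 T)
      (f' := fun t => 2 * (g t - C) * y t ^ 2 * Real.exp (-(2 * C) * t))
      ((hy.pow 2).mul (by fun_prop)) ?_ ?_
    · intro t ht
      rw [interior_Icc] at ht ⊢
      have h1 : HasDerivAt (fun t => Real.exp (-(2 * C) * t))
          (Real.exp (-(2 * C) * t) * (-(2 * C))) t := by
        simpa using ((hasDerivAt_id t).const_mul (-(2 * C))).exp
      exact ((((hd t ht).pow 2).mul h1).congr_deriv (by simp; ring)).hasDerivWithinAt
    · intro t ht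
      rw [interior_Icc] at ht
      have h3 : g t - C ≤ 0 := by linarith [hg t ht]
      have : 0 ≤ y t ^ 2 * Real.exp (-(2 * C) * t) := by positivity
      nlinarith
  intro t ht
  have := hm (left_mem_Icc.2 (ht.1.trans ht.2)) ht ht.1
  simp only [h0] at this
  have h2 : 0 < Real.exp (-(2 * C) * t) := Real.exp_pos _
  have h3 : y t ^ 2 = 0 := by nlinarith [sq_nonneg (y t)]
  exact pow_eq_zero_iff (two_ne_zero) |>.1 h3

/-! ### Rescaled variables and the Gauss and Codazzi relations -/

/-- `Σ̄ / √3` -/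
noncomputable def barNorm (S : State) : ℝ := sigBar S / √3

/-- `Ω / G₊` -/
noncomputable def fluid (w : ℝ) (S : State) : ℝ := (gPlus w S)⁻¹ * om S

/-- A box that contains the state space. -/
def box : Set State := Icc ![-1, -1, -1, -1, -1, 0] 1

theorem sigBar_eq (S : State) : sigBar S = √3 * barNorm S := by
  unfold barNorm; field_simp

theorem gPlus_pos {w : ℝ} (hw : -1 < w) {S : State} (h0 : 0 ≤ vSq S) (h1 : vSq S ≤ 1) :
    0 < gPlus w S := by
  unfold gPlus
  rcases le_total 0 w with h | h <;> nlinarith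

theorem gMinus_pos {w : ℝ} (hw : w < 1) {S : State} (h0 : 0 ≤ vSq S) (h1 : vSq S ≤ 1) :
    0 < gMinus w S := by
  unfold gMinus
  rcases le_total 0 w with h | h <;> nlinarith

theorem om_eq {w : ℝ} {S : State} (hg : gPlus w S ≠ 0) :
    om S = fluid w S * (1 + w * vSq S) := by
  unfold fluid
  rw [mul_comm (gPlus w S)⁻¹, mul_assoc]
  show _ = om S * ((gPlus w S)⁻¹ * gPlus w S)
  rw [inv_mul_cancel₀ hg, mul_one]

theorem gauss_eq {w : ℝ} {S : State} (hg : gPlus w S ≠ 0) :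
    sigPlus S ^ 2 + 3 * barNorm S ^ 2 + sigTildeSq S + sigCheckSq S + omK S
      + fluid w S * (1 + w * vSq S) = 1 := by
  have h := om_eq hg
  have h3 : √3 ^ 2 = (3 : ℝ) := Real.sq_sqrt (by norm_num)
  rw [← h]
  unfold om sigSq
  rw [sigBar_eq]
  linear_combination (-barNorm S ^ 2) * h3

/-- Eliminating `Σ²` through the Gauss constraint makes `q` affine in `Ω_k`, `Ω / G₊` and `v² Ω /
G₊`, so the later identities and fixed point equations are largely linear in these. -/
theorem decel_eq {w : ℝ} {S : State} (hg : gPlus w S ≠ 0) :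
    decel w S = 2 - 2 * omK S
      - (1 / 2) * fluid w S * (3 * (1 - w) + (5 * w - 1) * vSq S) := by
  have h1 := om_eq hg
  have h2 : decel w S = 2 * sigSq S
      + (1 / 2) * (1 + 3 * w + (1 - w) * vSq S) * fluid w S := by
    unfold decel fluid; ring
  have h3 : sigSq S = 1 - om S - omK S := by unfold om; ring
  rw [h2, h3, h1]; ring

theorem codazzi_eq (w : ℝ) (S : State) :
    codazzi w S = 4 * sigCheckSq S * omK S - (1 + w) ^ 2 * vSq S * fluid w S ^ 2 := by
  unfold codazzi fluid; ring

/-- The logarithmic derivative of `Ω`. -/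
noncomputable def omRate (w : ℝ) (S : State) : ℝ :=
  2 * decel w S - (1 + 3 * w)
    + (1 + w) * vSq S * (gPlus w S)⁻¹ * (3 * w - 1 - sigPlus S - √3 * sigBar S)

/-- The logarithmic derivative of `v²`, divided by `1 - v²`. -/
noncomputable def tiltRate (w : ℝ) (S : State) : ℝ :=
  2 * (gMinus w S)⁻¹ * (3 * w - 1 - sigPlus S - √3 * sigBar S)

/-- The logarithmic derivative of the Codazzi constraint function. -/
noncomputable def codazziRate (w : ℝ) (S : State) : ℝ :=
  4 * decel w S - 4 - 2 * sigPlus S - 2 * √3 * sigBar S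

/-! ### Evolution of the coordinates, of `Ω`, and of the constraint -/

section Derivatives

variable {w : ℝ} {γ : ℝ → State} {s : Set ℝ} {t : ℝ}

theorem hasDerivWithinAt_sigPlus (h : HasDerivWithinAt γ (field w (γ t)) s t) :
    HasDerivWithinAt (fun τ => sigPlus (γ τ))
      (-(2 - decel w (γ t)) * sigPlus (γ t) - 3 * sigCheckSq (γ t) + 4 * omK (γ t)
        + (1 / 2) * (1 + w) * vSq (γ t) * fluid w (γ t)) s t :=
  (hasDerivWithinAt_pi.1 h 0).congr_deriv (by simp only [field, fluid, Matrix.cons_val]; ring)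

theorem hasDerivWithinAt_barNorm (h : HasDerivWithinAt γ (field w (γ t)) s t) :
    HasDerivWithinAt (fun τ => barNorm (γ τ))
      (-(2 - decel w (γ t)) * barNorm (γ t) - 2 * sigTildeSq (γ t) + sigCheckSq (γ t)
        + (1 / 2) * (1 + w) * vSq (γ t) * fluid w (γ t)) s t :=
  ((hasDerivWithinAt_pi.1 h 1).div_const (√3)).congr_deriv (by
    simp only [field, fluid, barNorm, Matrix.cons_val]; field_simp)

theorem hasDerivWithinAt_sigTildeSq (h : HasDerivWithinAt γ (field w (γ t)) s t) :
    HasDerivWithinAt (fun τ => sigTildeSq (γ τ))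
      ((-2 * (2 - decel w (γ t) - 2 * √3 * sigBar (γ t))) * sigTildeSq (γ t)) s t :=
  (hasDerivWithinAt_pi.1 h 2).congr_deriv (by simp [field])

theorem hasDerivWithinAt_sigCheckSq (h : HasDerivWithinAt γ (field w (γ t)) s t) :
    HasDerivWithinAt (fun τ => sigCheckSq (γ τ))
      ((-2 * (2 - decel w (γ t) - 3 * sigPlus (γ t) + √3 * sigBar (γ t))) * sigCheckSq (γ t))
      s t :=
  (hasDerivWithinAt_pi.1 h 3).congr_deriv (by simp [field])

theorem hasDerivWithinAt_omK (h : HasDerivWithinAt γ (field w (γ t)) s t) :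
    HasDerivWithinAt (fun τ => omK (γ τ))
      ((2 * (decel w (γ t) - 4 * sigPlus (γ t))) * omK (γ t)) s t :=
  (hasDerivWithinAt_pi.1 h 4).congr_deriv (by simp [field])

theorem hasDerivWithinAt_vSq (h : HasDerivWithinAt γ (field w (γ t)) s t) :
    HasDerivWithinAt (fun τ => vSq (γ τ))
      (((1 - vSq (γ t)) * tiltRate w (γ t)) * vSq (γ t)) s t :=
  (hasDerivWithinAt_pi.1 h 5).congr_deriv (by simp only [field, tiltRate, Matrix.cons_val]; ring)

theorem hasDerivWithinAt_one_sub_vSq (h : HasDerivWithinAt γ (field w (γ t)) s t) :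
    HasDerivWithinAt (fun τ => 1 - vSq (γ τ))
      ((-vSq (γ t) * tiltRate w (γ t)) * (1 - vSq (γ t))) s t :=
  ((hasDerivWithinAt_vSq h).const_sub 1).congr_deriv (by ring)

theorem hasDerivWithinAt_om (h : HasDerivWithinAt γ (field w (γ t)) s t)
    (hg : gPlus w (γ t) ≠ 0) :
    HasDerivWithinAt (fun τ => om (γ τ)) (omRate w (γ t) * om (γ t)) s t := by
  have h3 : √3 ^ 2 = (3 : ℝ) := Real.sq_sqrt (by norm_num)
  have h0 := hasDerivWithinAt_sigPlus h
  have h1 := (hasDerivWithinAt_pi.1 h 1)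
  have hT := hasDerivWithinAt_sigTildeSq h
  have hC := hasDerivWithinAt_sigCheckSq h
  have hK := hasDerivWithinAt_omK h
  have := (((((h0.pow 2).add (h1.pow 2)).add hT).add hC).const_sub 1).sub hK
  refine this.congr_deriv ?_
  have hU := om_eq hg
  have hb := sigBar_eq (γ t)
  have hG := gauss_eq hg
  have hq := decel_eq hg
  have e : omRate w (γ t) * om (γ t) = (2 * decel w (γ t) - (1 + 3 * w)) * om (γ t)
      + (1 + w) * vSq (γ t) * fluid w (γ t)
        * (3 * w - 1 - sigPlus (γ t) - √3 * sigBar (γ t)) := by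
    unfold omRate fluid; ring
  have f1 : field w (γ t) 1 = -(2 - decel w (γ t)) * sigBar (γ t) - 2 * √3 * sigTildeSq (γ t)
      + √3 * sigCheckSq (γ t) + (√3 / 2) * (1 + w) * vSq (γ t) * fluid w (γ t) := by
    simp only [field, fluid, Matrix.cons_val]; ring
  rw [e, f1, hU]
  simp only [Nat.cast_ofNat, Nat.add_one_sub_one, pow_one]
  change -(2 * sigPlus (γ t) * _ + 2 * sigBar (γ t) * _ + _ + _) - _ = _
  rw [hb]
  generalize sigPlus (γ t) = p at *
  generalize barNorm (γ t) = X at *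
  generalize sigTildeSq (γ t) = T at *
  generalize sigCheckSq (γ t) = C at *
  generalize omK (γ t) = K at *
  generalize vSq (γ t) = v at *
  generalize fluid w (γ t) = U at *
  rw [hq]
  -- The multiplier of the Gauss identity is `2 (2 - q)`, with `q` expanded.
  linear_combination
    (2 * (2 * K + 1 / 2 * U * (3 * (1 - w) + (5 * w - 1) * v))) * (X ^ 2 * h3 + hG)

/-- The logarithmic derivative of `Ω / G₊`. -/
theorem hasDerivWithinAt_fluid (h : HasDerivWithinAt γ (field w (γ t)) s t)
    (hg : gPlus w (γ t) ≠ 0) :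
    HasDerivWithinAt (fun τ => fluid w (γ τ))
      ((omRate w (γ t) - w * vSq (γ t) * (1 - vSq (γ t)) * tiltRate w (γ t) * (gPlus w (γ t))⁻¹)
        * fluid w (γ t)) s t := by
  have hG : HasDerivWithinAt (fun τ => gPlus w (γ τ))
      (w * (((1 - vSq (γ t)) * tiltRate w (γ t)) * vSq (γ t))) s t :=
    ((hasDerivWithinAt_vSq h).const_mul w).const_add 1
  refine ((hG.inv hg).mul (hasDerivWithinAt_om h hg)).congr_deriv ?_
  simp only [fluid, Pi.inv_apply]
  field_simp
  ring

/-- The two terms `Σ̌² Ω_k` and `v² (Ω / G₊)²` have the same logarithmic derivative, even off the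
constraint surface. Hence their difference obeys a homogeneous linear equation and stays zero. -/
theorem hasDerivWithinAt_codazzi (h : HasDerivWithinAt γ (field w (γ t)) s t)
    (hg : gPlus w (γ t) ≠ 0) (hm : gMinus w (γ t) ≠ 0) :
    HasDerivWithinAt (fun τ => codazzi w (γ τ)) (codazziRate w (γ t) * codazzi w (γ t)) s t := by
  have e : (fun τ => codazzi w (γ τ)) = fun τ => 4 * (sigCheckSq (γ τ) * omK (γ τ))
      - (1 + w) ^ 2 * (vSq (γ τ) * fluid w (γ τ) ^ 2) := by
    funext τ; rw [codazzi_eq]; ring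
  rw [e]
  have h1 := (((hasDerivWithinAt_sigCheckSq h).mul (hasDerivWithinAt_omK h)).const_mul 4).sub
    (((hasDerivWithinAt_vSq h).mul ((hasDerivWithinAt_fluid h hg).pow 2)).const_mul ((1 + w) ^ 2))
  refine h1.congr_deriv ?_
  have key : (1 - vSq (γ t)) * tiltRate w (γ t) + 2 * (omRate w (γ t)
      - w * vSq (γ t) * (1 - vSq (γ t)) * tiltRate w (γ t) * (gPlus w (γ t))⁻¹)
      = codazziRate w (γ t) := by
    unfold omRate tiltRate codazziRate
    have h2 : gPlus w (γ t) = 1 + w * vSq (γ t) := rfl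
    have h3 : gMinus w (γ t) = 1 - w * vSq (γ t) := rfl
    field_simp
    rw [h2, h3]
    ring
  rw [codazzi_eq, ← key]
  have key2 : codazziRate w (γ t) = -2 * (2 - decel w (γ t) - 3 * sigPlus (γ t) + √3 * sigBar (γ t))
      + 2 * (decel w (γ t) - 4 * sigPlus (γ t)) := by
    unfold codazziRate; ring
  rw [← key] at key2
  simp only [Nat.cast_ofNat, Nat.add_one_sub_one, pow_one, Pi.pow_apply]
  linear_combination (-4 * sigCheckSq (γ t) * omK (γ t)) * key2

end Derivatives

/-! ### Invariance of `sGen` and existence of orbits -/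

section Box

variable {w : ℝ}

theorem isCompact_box : IsCompact box := isCompact_Icc

theorem mem_box_iff {S : State} : S ∈ box ↔ (-1 ≤ sigPlus S ∧ sigPlus S ≤ 1) ∧
    (-1 ≤ sigBar S ∧ sigBar S ≤ 1) ∧ (-1 ≤ sigTildeSq S ∧ sigTildeSq S ≤ 1) ∧
    (-1 ≤ sigCheckSq S ∧ sigCheckSq S ≤ 1) ∧ (-1 ≤ omK S ∧ omK S ≤ 1) ∧
    (0 ≤ vSq S ∧ vSq S ≤ 1) := by
  simp only [box, mem_Icc, Pi.le_def, Fin.forall_fin_succ]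
  simp
  tauto

/-- The part of phase space where the strict inequalities defining `sGen` hold. -/
def openPart : Set State :=
  {S | 0 < sigTildeSq S ∧ 0 < sigCheckSq S ∧ 0 < omK S ∧ 0 < vSq S ∧ 0 < 1 - vSq S ∧ 0 < om S}

theorem mem_sGen_iff {S : State} : S ∈ sGen w ↔ S ∈ openPart ∧ codazzi w S = 0 := by
  constructor
  · rintro ⟨⟨h, hT, hC, hK, hv, hv', hO⟩, hne⟩
    simp only [mul_ne_zero_iff] at hne
    obtain ⟨⟨⟨⟨⟨h1, h2⟩, h3⟩, h4⟩, h5⟩, h6⟩ := hne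
    exact ⟨⟨hT.lt_of_ne' h3, hC.lt_of_ne' h4, hK.lt_of_ne' h6, hv.lt_of_ne' h2,
      (sub_nonneg.2 hv').lt_of_ne' h1, hO.lt_of_ne' h5⟩, h⟩
  · rintro ⟨⟨hT, hC, hK, hv, hv', hO⟩, h⟩
    exact ⟨⟨h, hT.le, hC.le, hK.le, hv.le, (sub_pos.1 hv').le, hO.le⟩, by positivity⟩

theorem continuous_om : Continuous om := by
  unfold om sigSq; fun_prop

theorem isOpen_openPart : IsOpen openPart := by
  have h := continuous_om
  exact (isOpen_lt continuous_const (continuous_apply 2)).inter <|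
    (isOpen_lt continuous_const (continuous_apply 3)).inter <|
    (isOpen_lt continuous_const (continuous_apply 4)).inter <|
    (isOpen_lt continuous_const (continuous_apply 5)).inter <|
    (isOpen_lt continuous_const (continuous_const.sub (continuous_apply 5))).inter
      (isOpen_lt continuous_const h)

theorem stateSpace_subset_box : stateSpace w ⊆ box := by
  rintro S ⟨-, hT, hC, hK, hv, hv', hO⟩
  have h : om S = 1 - (sigPlus S ^ 2 + sigBar S ^ 2 + sigTildeSq S + sigCheckSq S) - omK S := rfl
  have h0 := sq_nonneg (sigPlus S)
  have h1 := sq_nonneg (sigBar S)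
  have a0 : |sigPlus S| ≤ 1 := abs_le_one_iff_mul_self_le_one.2 (by nlinarith)
  have a1 : |sigBar S| ≤ 1 := abs_le_one_iff_mul_self_le_one.2 (by nlinarith)
  exact mem_box_iff.2 ⟨abs_le.1 a0, abs_le.1 a1, ⟨by linarith, by linarith⟩,
    ⟨by linarith, by linarith⟩, ⟨by linarith, by linarith⟩, hv, hv'⟩

theorem openPart_subset_box : openPart ⊆ box := by
  rintro S ⟨hT, hC, hK, hv, hv', hO⟩
  have h : om S = 1 - (sigPlus S ^ 2 + sigBar S ^ 2 + sigTildeSq S + sigCheckSq S) - omK S := rfl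
  have h0 := sq_nonneg (sigPlus S)
  have h1 := sq_nonneg (sigBar S)
  have a0 : |sigPlus S| ≤ 1 := abs_le_one_iff_mul_self_le_one.2 (by nlinarith)
  have a1 : |sigBar S| ≤ 1 := abs_le_one_iff_mul_self_le_one.2 (by nlinarith)
  exact mem_box_iff.2 ⟨abs_le.1 a0, abs_le.1 a1, ⟨by linarith, by linarith⟩,
    ⟨by linarith, by linarith⟩, ⟨by linarith, by linarith⟩, hv.le, by linarith⟩

theorem gPlus_ne_zero_of_mem_box (hw : -1 < w) {S : State} (hS : S ∈ box) : gPlus w S ≠ 0 :=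
  have h := (mem_box_iff.1 hS).2.2.2.2.2
  (gPlus_pos hw h.1 h.2).ne'

theorem gMinus_ne_zero_of_mem_box (hw : w < 1) {S : State} (hS : S ∈ box) : gMinus w S ≠ 0 :=
  have h := (mem_box_iff.1 hS).2.2.2.2.2
  (gMinus_pos hw h.1 h.2).ne'

theorem continuousOn_inv_gPlus (hw : -1 < w) : ContinuousOn (fun S => (gPlus w S)⁻¹) box :=
  ContinuousOn.inv₀ (by unfold gPlus; fun_prop) fun _ hS => gPlus_ne_zero_of_mem_box hw hS

theorem continuousOn_inv_gMinus (hw : w < 1) : ContinuousOn (fun S => (gMinus w S)⁻¹) box :=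
  ContinuousOn.inv₀ (by unfold gMinus; fun_prop) fun _ hS => gMinus_ne_zero_of_mem_box hw hS

theorem continuousOn_fluid (hw : -1 < w) : ContinuousOn (fluid w) box :=
  (continuousOn_inv_gPlus hw).mul continuous_om.continuousOn

theorem continuousOn_decel (hw : -1 < w) : ContinuousOn (decel w) box := by
  have h := continuousOn_inv_gPlus hw
  have h' := continuous_om.continuousOn (s := box)
  unfold decel sigSq
  fun_prop

theorem continuousOn_omRate (hw : -1 < w) : ContinuousOn (omRate w) box := by
  have h := continuousOn_inv_gPlus hw
  have h' := continuousOn_decel hw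
  unfold omRate
  fun_prop

theorem continuousOn_tiltRate (hw : w < 1) : ContinuousOn (tiltRate w) box := by
  have h := continuousOn_inv_gMinus hw
  unfold tiltRate
  fun_prop

theorem continuousOn_codazziRate (hw : -1 < w) : ContinuousOn (codazziRate w) box := by
  have h' := continuousOn_decel hw
  unfold codazziRate
  fun_prop

theorem continuousOn_codazzi (hw : -1 < w) : ContinuousOn (codazzi w) box := by
  have h := continuousOn_inv_gPlus hw
  have h' := continuous_om.continuousOn (s := box)
  unfold codazzi
  fun_prop

theorem isClosed_stateSpace (hw : -1 < w) : IsClosed (stateSpace w) := by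
  have e : stateSpace w = (box ∩ codazzi w ⁻¹' {0}) ∩ {S | 0 ≤ sigTildeSq S ∧ 0 ≤ sigCheckSq S ∧
      0 ≤ omK S ∧ 0 ≤ vSq S ∧ vSq S ≤ 1 ∧ 0 ≤ om S} := by
    ext S
    constructor
    · exact fun h => ⟨⟨stateSpace_subset_box h, h.1⟩, h.2⟩
    · exact fun h => ⟨h.1.2, h.2⟩
  rw [e]
  have h := continuous_om
  refine ((continuousOn_codazzi hw).preimage_isClosed_of_isClosed isCompact_box.isClosed
    isClosed_singleton).inter ?_
  exact (isClosed_le continuous_const (continuous_apply 2)).inter <|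
    (isClosed_le continuous_const (continuous_apply 3)).inter <|
    (isClosed_le continuous_const (continuous_apply 4)).inter <|
    (isClosed_le continuous_const (continuous_apply 5)).inter <|
    (isClosed_le (continuous_apply 5) continuous_const).inter (isClosed_le continuous_const h)

theorem isCompact_stateSpace (hw : -1 < w) : IsCompact (stateSpace w) :=
  isCompact_box.of_isClosed_subset (isClosed_stateSpace hw) stateSpace_subset_box

/-- A curve that starts in `sGen` and is an integral curve as long as it is in the box stays in
`sGen`. -/
theorem mem_sGen_of_hasDerivWithinAt (hw : -1 < w) (hw' : w < 1) {γ : ℝ → State}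
    (h0 : γ 0 ∈ sGen w) (hc : ContinuousOn γ (Ici 0))
    (hd : ∀ t ∈ Ici (0 : ℝ), γ t ∈ box → HasDerivWithinAt γ (field w (γ t)) (Ici 0) t) :
    ∀ t ∈ Ici (0 : ℝ), γ t ∈ sGen w := by
  have hzero : ∀ T, 0 ≤ T → (∀ t ∈ Ico 0 T, γ t ∈ openPart) → γ T ∈ box → codazzi w (γ T) = 0 := by
    intro T hT hop hTb
    have hb : ∀ t ∈ Icc 0 T, γ t ∈ box := by
      intro t ht
      rcases ht.2.eq_or_lt with rfl | h
      · exact hTb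
      · exact openPart_subset_box (hop t ⟨ht.1, h⟩)
    have hcT : ContinuousOn γ (Icc 0 T) := hc.mono fun t ht => ht.1
    obtain ⟨C, hC⟩ := (isCompact_box.image_of_continuousOn (continuousOn_codazziRate hw)).bddAbove
    refine eq_zero_of_linear_deriv (y := fun t => codazzi w (γ t))
      (g := fun t => codazziRate w (γ t)) (C := C) ((continuousOn_codazzi hw).comp hcT hb)
      (fun t ht => ?_) (fun t ht => ?_) (mem_sGen_iff.1 h0).2 T (right_mem_Icc.2 hT)
    · have := hb t (Ioo_subset_Icc_self ht)
      exact (hasDerivWithinAt_codazzi (hd t ht.1.le this) (gPlus_ne_zero_of_mem_box hw this)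
        (gMinus_ne_zero_of_mem_box hw' this)).hasDerivAt (Ici_mem_nhds ht.1)
    · exact hC (mem_image_of_mem _ (hb t (Ioo_subset_Icc_self ht)))
  have hopen : ∀ t ∈ Ici (0 : ℝ), γ t ∈ openPart := by
    by_contra! hcon
    obtain ⟨t₁, ht₁, hbad⟩ := hcon
    have hne : (Ici (0 : ℝ) ∩ γ ⁻¹' openPartᶜ).Nonempty := ⟨t₁, ht₁, hbad⟩
    have hcl : IsClosed (Ici (0 : ℝ) ∩ γ ⁻¹' openPartᶜ) :=
      hc.preimage_isClosed_of_isClosed isClosed_Ici isOpen_openPart.isClosed_compl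
    have hbdd : BddBelow (Ici (0 : ℝ) ∩ γ ⁻¹' openPartᶜ) := ⟨0, fun t ht => ht.1⟩
    obtain ⟨hT0, hTbad⟩ := hcl.csInf_mem hne hbdd
    -- `T` is the first exit time from the open part. It is attained, and up to and including `T`
    -- the curve is in the closed box, where all coefficients are bounded.
    set T := sInf (Ici (0 : ℝ) ∩ γ ⁻¹' openPartᶜ) with hTdef
    have hop : ∀ t ∈ Ico 0 T, γ t ∈ openPart := by
      intro t ht
      by_contra hcon
      exact absurd (csInf_le hbdd ⟨ht.1, hcon⟩) (not_le.2 ht.2)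
    have hTpos : 0 < T := by
      rcases (show (0 : ℝ) ≤ T from hT0).eq_or_lt with h | h
      · exact absurd (mem_sGen_iff.1 h0).1 (by rw [h]; exact hTbad)
      · exact h
    have hcT : ContinuousOn γ (Icc 0 T) := hc.mono fun t ht => ht.1
    have hTb : γ T ∈ box := by
      have hcw : ContinuousWithinAt γ (Ico 0 T) T :=
        (hcT T (right_mem_Icc.2 hTpos.le)).mono Ico_subset_Icc_self
      refine isCompact_box.isClosed.closure_subset_iff.2 openPart_subset_box
        (hcw.mem_closure ?_ hop)
      rw [closure_Ico hTpos.ne]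
      exact right_mem_Icc.2 hTpos.le
    have hb : ∀ t ∈ Icc 0 T, γ t ∈ box := by
      intro t ht
      rcases ht.2.eq_or_lt with rfl | h
      · exact hTb
      · exact openPart_subset_box (hop t ⟨ht.1, h⟩)
    have main : ∀ (φ g : State → ℝ), Continuous φ → ContinuousOn g box →
        (∀ S ∈ openPart, 0 < φ S) → (∀ t ∈ Ici (0 : ℝ), γ t ∈ box →
          HasDerivWithinAt (fun τ => φ (γ τ)) (g (γ t) * φ (γ t)) (Ici 0) t) → 0 < φ (γ T) := by
      intro φ g hφ hg hpos hder
      obtain ⟨C, hC⟩ := (isCompact_box.image_of_continuousOn hg).bddBelow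
      refine pos_of_linear_deriv (y := fun t => φ (γ t)) (g := fun t => g (γ t)) (C := -C)
        hTpos.le (hφ.comp_continuousOn hcT) (fun t ht => ?_) (fun t ht => ?_)
        (fun t ht => hpos _ (hop t ht)) (hpos _ (hop 0 ⟨le_rfl, hTpos⟩))
      · exact (hder t ht.1.le (hb t (Ioo_subset_Icc_self ht))).hasDerivAt (Ici_mem_nhds ht.1)
      · rw [neg_neg]
        exact hC (mem_image_of_mem _ (hb t (Ioo_subset_Icc_self ht)))
    have hq := continuousOn_decel hw
    have htr := continuousOn_tiltRate hw'
    refine hTbad ⟨?_, ?_, ?_, ?_, ?_, ?_⟩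
    · exact main sigTildeSq (fun S => -2 * (2 - decel w S - 2 * √3 * sigBar S))
        (by fun_prop) (by fun_prop) (fun S hS => hS.1)
        fun t ht hbt => hasDerivWithinAt_sigTildeSq (hd t ht hbt)
    · exact main sigCheckSq
        (fun S => -2 * (2 - decel w S - 3 * sigPlus S + √3 * sigBar S)) (by fun_prop) (by fun_prop) (fun S hS => hS.2.1)
        fun t ht hbt => hasDerivWithinAt_sigCheckSq (hd t ht hbt)
    · exact main omK (fun S => 2 * (decel w S - 4 * sigPlus S)) (by fun_prop) (by fun_prop) (fun S hS => hS.2.2.1)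
        fun t ht hbt => hasDerivWithinAt_omK (hd t ht hbt)
    · exact main vSq (fun S => (1 - vSq S) * tiltRate w S) (by fun_prop) (by fun_prop)
        (fun S hS => hS.2.2.2.1) fun t ht hbt => hasDerivWithinAt_vSq (hd t ht hbt)
    · exact main (fun S => 1 - vSq S) (fun S => -vSq S * tiltRate w S) (by fun_prop) (by fun_prop)
        (fun S hS => hS.2.2.2.2.1) fun t ht hbt => hasDerivWithinAt_one_sub_vSq (hd t ht hbt)
    · exact main om (omRate w) continuous_om (continuousOn_omRate hw) (fun S hS => hS.2.2.2.2.2)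
        fun t ht hbt => hasDerivWithinAt_om (hd t ht hbt) (gPlus_ne_zero_of_mem_box hw hbt)
  intro t ht
  exact mem_sGen_iff.2 ⟨hopen t ht, hzero t ht (fun s hs => hopen s hs.1)
    (openPart_subset_box (hopen t ht))⟩

theorem contDiffAt_field (hw : -1 < w) (hw' : w < 1) {S : State} (hS : S ∈ box) :
    ContDiffAt ℝ 1 (field w) S := by
  have hg := gPlus_ne_zero_of_mem_box hw hS
  have hm := gMinus_ne_zero_of_mem_box hw' hS
  have c0 : ∀ i : Fin 6, ContDiffAt ℝ 1 (fun S : State => S i) S := fun i => by fun_prop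
  have c1 : ContDiffAt ℝ 1 (fun S => (gPlus w S)⁻¹) S :=
    ContDiffAt.inv (by unfold gPlus; fun_prop) hg
  have c2 : ContDiffAt ℝ 1 (fun S => (gMinus w S)⁻¹) S :=
    ContDiffAt.inv (by unfold gMinus; fun_prop) hm
  have c3 : ContDiffAt ℝ 1 om S := by unfold om sigSq; fun_prop
  have c4 : ContDiffAt ℝ 1 (decel w) S := by unfold decel sigSq; fun_prop
  rw [contDiffAt_pi]
  intro i
  fin_cases i <;> simp only [field, Matrix.cons_val, Fin.reduceFinMk, Fin.isValue, Fin.zero_eta,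
    Fin.mk_one] <;> fun_prop

theorem exists_isFutureOrbit (hw : -1 < w) (hw' : w < 1) {x : State} (hx : x ∈ sGen w) :
    ∃ γ : ℝ → State, IsFutureOrbit w x γ := by
  have hdiff : ContDiffOn ℝ 1 (field w) box := fun S hS =>
    (contDiffAt_field hw hw' hS).contDiffWithinAt
  have hne : box.Nonempty := ⟨x, openPart_subset_box (mem_sGen_iff.1 hx).1⟩
  have hle : ![-1, -1, -1, -1, -1, 0] ≤ (1 : State) := nonempty_Icc.1 hne
  have hll : LocallyLipschitzOn box (field w) := by
    intro S hS
    obtain ⟨K, s, hs, h⟩ := (contDiffAt_field hw hw' hS).exists_lipschitzOnWith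
    exact ⟨K, s, mem_nhdsWithin_of_mem_nhds hs, h⟩
  obtain ⟨K, hK⟩ := hll.exists_lipschitzOnWith_of_compact isCompact_box
  obtain ⟨M, hM⟩ := isCompact_box.exists_bound_of_continuousOn hdiff.continuousOn
  set a : State := ![-1, -1, -1, -1, -1, 0] with ha
  -- Composing the field with this retraction onto the box makes it bounded and globally Lipschitz.
  -- The resulting curve never leaves the box, so it solves the original system.
  let clamp : State → State := fun S => a ⊔ (1 ⊓ S)
  have hmem : ∀ S, clamp S ∈ box := fun S => ⟨le_sup_left, sup_le hle inf_le_left⟩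
  have hid : ∀ S ∈ box, clamp S = S := by
    intro S hS
    show a ⊔ (1 ⊓ S) = S
    rw [inf_eq_right.2 hS.2, sup_eq_right.2 hS.1]
  have hclamp : LipschitzWith 1 clamp := by
    refine LipschitzWith.of_dist_le_mul fun S S' => ?_
    rw [NNReal.coe_one, one_mul, dist_pi_le_iff dist_nonneg]
    intro i
    refine le_trans ?_ (dist_le_pi_dist S S' i)
    show |max (a i) (min 1 (S i)) - max (a i) (min 1 (S' i))| ≤ |S i - S' i|
    refine (abs_max_sub_max_le_max _ _ _ _).trans ?_
    rw [sub_self, abs_zero, max_eq_right (abs_nonneg _)]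
    refine (abs_min_sub_min_le_max _ _ _ _).trans ?_
    rw [sub_self, abs_zero, max_eq_right (abs_nonneg _)]
  have hF : LipschitzWith (K * 1) (fun S => field w (clamp S)) := by
    have := hK.comp (hclamp.lipschitzOnWith (s := univ)) (fun S _ => hmem S)
    exact lipschitzOnWith_univ.1 this
  obtain ⟨γ, h0, hγ⟩ := exists_isIntegralCurveOn_Ici (M := M.toNNReal) hF
    (fun S => (hM _ (hmem S)).trans (Real.le_coe_toNNReal M)) x
  refine ⟨γ, h0, ?_⟩
  have hd : ∀ t ∈ Ici (0 : ℝ), γ t ∈ box →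
      HasDerivWithinAt γ (field w (γ t)) (Ici 0) t := by
    intro t ht hb
    have := hγ t ht
    simp only [hid _ hb] at this
    exact this
  have hin := mem_sGen_of_hasDerivWithinAt hw hw' (h0 ▸ hx)
    (fun t ht => (hγ t ht).continuousWithinAt) hd
  exact fun t ht => hd t ht (openPart_subset_box (mem_sGen_iff.1 (hin t ht)).1)

end Box

/-! ### Cluster points of orbits -/

section Orbits

variable {w : ℝ} {x : State} {γ : ℝ → State}

theorem IsFutureOrbit.mem_sGen (hw : -1 < w) (hw' : w < 1) (hx : x ∈ sGen w)
    (hγ : IsFutureOrbit w x γ) : ∀ t ∈ Ici (0 : ℝ), γ t ∈ sGen w :=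
  mem_sGen_of_hasDerivWithinAt hw hw' (by rw [hγ.1]; exact hx)
    (fun t ht => (hγ.2 t ht).continuousWithinAt) fun t ht _ => hγ.2 t ht

theorem IsFutureOrbit.mem_stateSpace (hw : -1 < w) (hw' : w < 1) (hx : x ∈ sGen w)
    (hγ : IsFutureOrbit w x γ) : ∀ t ∈ Ici (0 : ℝ), γ t ∈ stateSpace w :=
  fun t ht => (hγ.mem_sGen hw hw' hx t ht).1

theorem continuousOn_field (hw : -1 < w) (hw' : w < 1) : ContinuousOn (field w) box :=
  fun _ hS => (contDiffAt_field hw hw' hS).continuousAt.continuousWithinAt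

/-- Orbits have bounded speed, and continuous functions on the compact state space are uniformly
continuous. This supplies the hypothesis of Barbalat's lemma. -/
theorem IsFutureOrbit.uniformContinuousOn_comp (hw : -1 < w) (hw' : w < 1) (hx : x ∈ sGen w)
    (hγ : IsFutureOrbit w x γ) {ψ : State → ℝ} (hψ : ContinuousOn ψ (stateSpace w)) :
    UniformContinuousOn (fun t => ψ (γ t)) (Ici 0) := by
  obtain ⟨M, hM⟩ := isCompact_box.exists_bound_of_continuousOn (continuousOn_field hw hw')
  have hmem := hγ.mem_stateSpace hw hw' hx
  have hlip : LipschitzOnWith M.toNNReal γ (Ici 0) :=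
    (convex_Ici 0).lipschitzOnWith_of_nnnorm_hasDerivWithin_le (fun t ht => hγ.2 t ht)
      fun t ht => by
        have := hM _ (stateSpace_subset_box (hmem t ht))
        rw [← NNReal.coe_le_coe]
        exact this.trans (Real.le_coe_toNNReal M)
  exact ((isCompact_stateSpace hw).uniformContinuousOn_of_continuous hψ).comp
    hlip.uniformContinuousOn hmem

/-- If a function has the same value at all cluster points of an orbit, its derivative along the
flow vanishes at them. -/
theorem IsFutureOrbit.deriv_eq_zero_of_mapClusterPt (hw : -1 < w) (hw' : w < 1) (hx : x ∈ sGen w)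
    (hγ : IsFutureOrbit w x γ) {φ ψ : State → ℝ} {c : ℝ} (hφ : ContinuousOn φ (stateSpace w))
    (hψ : ContinuousOn ψ (stateSpace w))
    (hd : ∀ t ∈ Ici (0 : ℝ), HasDerivWithinAt (fun τ => φ (γ τ)) (ψ (γ t)) (Ici 0) t)
    (h : ∀ y ∈ stateSpace w, MapClusterPt y atTop γ → φ y = c) {y : State}
    (hy : MapClusterPt y atTop γ) : ψ y = 0 := by
  have hmem := hγ.mem_stateSpace hw hw' hx
  have h1 := tendsto_of_forall_mapClusterPt (isCompact_stateSpace hw) hmem hφ h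
  have h2 := tendsto_deriv_zero_of_tendsto hd (hγ.uniformContinuousOn_comp hw hw' hx hψ) h1
  exact (eq_of_mapClusterPt (isClosed_stateSpace hw) hmem hψ h2 hy).2

/-- Compactness turns uniqueness of the cluster point into convergence, so the ω-limit set is also
nonempty. -/
theorem IsFutureOrbit.omegaSet_eq_singleton (hw : -1 < w) (hw' : w < 1) (hx : x ∈ sGen w)
    (hγ : IsFutureOrbit w x γ) {p : State} (h : ∀ y, MapClusterPt y atTop γ → y = p) :
    omegaSet γ = {p} := by
  have hmem : ∀ᶠ t in atTop, γ t ∈ stateSpace w :=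
    (eventually_ge_atTop (0 : ℝ)).mono fun t ht => hγ.mem_stateSpace hw hw' hx t ht
  have hp : MapClusterPt p atTop γ :=
    ((isCompact_stateSpace hw).tendsto_nhds_of_unique_mapClusterPt hmem
      fun y _ hy => h y hy).mapClusterPt
  ext y
  unfold omegaSet
  rw [mem_omegaLimit_singleton_iff_mapClusterPt, mem_singleton_iff]
  exact ⟨h y, fun e => e ▸ hp⟩

theorem IsFutureOrbit.exists_mapClusterPt (hw : -1 < w) (hw' : w < 1) (hx : x ∈ sGen w)
    (hγ : IsFutureOrbit w x γ) : ∃ y, MapClusterPt y atTop γ := by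
  have hmem : ∀ᶠ t in atTop, γ t ∈ stateSpace w :=
    (eventually_ge_atTop (0 : ℝ)).mono fun t ht => hγ.mem_stateSpace hw hw' hx t ht
  obtain ⟨y, -, hy⟩ := (isCompact_stateSpace hw).exists_mapClusterPt (f := atTop) (u := γ)
    (le_principal_iff.2 hmem)
  exact ⟨y, hy⟩

theorem le_of_mapClusterPt {φ : State → ℝ} (hφ : Continuous φ) {c : ℝ}
    (h : ∀ t ∈ Ici (0 : ℝ), c ≤ φ (γ t)) {y : State} (hy : MapClusterPt y atTop γ) : c ≤ φ y := by
  obtain ⟨u, hu, hyu⟩ := mapClusterPt_iff_ultrafilter.1 hy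
  have hev : ∀ᶠ t in atTop, c ≤ φ (γ t) := (eventually_ge_atTop (0 : ℝ)).mono h
  exact ge_of_tendsto ((hφ.tendsto y).comp hyu) (hu hev)

theorem eq_of_mapClusterPt_of_continuousAt {φ : State → ℝ} {c : ℝ} {y : State}
    (hφ : ContinuousAt φ y) (h : Tendsto (fun t => φ (γ t)) atTop (𝓝 c))
    (hy : MapClusterPt y atTop γ) : φ y = c := by
  obtain ⟨u, hu, hyu⟩ := mapClusterPt_iff_ultrafilter.1 hy
  exact tendsto_nhds_unique (hφ.tendsto.comp hyu) (h.mono_left hu)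

end Orbits

/-! ### Monotone functions and the monotonicity principle -/

section Lyapunov

/-- The exponents of `Σ̃²`, `Σ̌²`, `Ω_k` and the matter density in a monotone function, together
with the coefficients of the linear form in its denominator. -/
structure Weights where
  /-- exponent of `Σ̃²` -/
  tilde : ℝ
  /-- exponent of `Σ̌²` -/
  check : ℝ
  /-- exponent of `Ω_k` -/
  curv : ℝ
  /-- exponent of the conserved matter density -/
  matter : ℝ
  /-- coefficient of `Σ₊` -/
  plus : ℝ
  /-- coefficient of `Σ̄ / √3` -/
  bar : ℝ

namespace Weights

variable (W : Weights) (w : ℝ)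

/-- The sum of the exponents. -/
def total : ℝ := W.tilde + W.check + W.curv + W.matter

/-- The squared length of the vector `(Σ₊, Σ̄)` that belongs to the linear form. -/
noncomputable def normSq : ℝ := W.plus ^ 2 + W.bar ^ 2 / 3

/-- The linear form in the denominator. -/
noncomputable def lin (S : State) : ℝ := 1 - W.plus * sigPlus S - W.bar * barNorm S

/-- The logarithm of the monotone function. -/
noncomputable def lyap (S : State) : ℝ :=
  W.tilde * Real.log (sigTildeSq S) + W.check * Real.log (sigCheckSq S)
    + W.curv * Real.log (omK S) + W.matter * Real.log (om S)
    + W.matter * ((1 - w) / 2) * Real.log (1 - vSq S)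
    + (-W.matter * Real.log (gPlus w S) - 2 * W.total * Real.log (W.lin S))

/-- The derivative of `lyap` along the flow. -/
noncomputable def lyapRate (S : State) : ℝ :=
  4 * (W.curv + W.matter) - (1 + 3 * w) * W.matter + (6 * W.check - 8 * W.curv) * sigPlus S
    + 6 * (2 * W.tilde - W.check) * barNorm S
    - 2 * W.total * ((2 - decel w S)
      - W.plus * (-3 * sigCheckSq S + 4 * omK S + (1 / 2) * (1 + w) * vSq S * fluid w S)
      - W.bar * (-2 * sigTildeSq S + sigCheckSq S + (1 / 2) * (1 + w) * vSq S * fluid w S))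
      / W.lin S

/-- The positive definite form that measures the distance of `(Σ₊, Σ̄)` from the fixed point. -/
noncomputable def dev (S : State) : ℝ :=
  (1 - W.normSq) * ((sigPlus S - W.plus) ^ 2 + 3 * (barNorm S - W.bar / 3) ^ 2)
    + (W.plus * (sigPlus S - W.plus) + W.bar * (barNorm S - W.bar / 3)) ^ 2

variable {W} {w : ℝ}

theorem continuous_barNorm : Continuous barNorm := by unfold barNorm; fun_prop

theorem continuous_lin : Continuous W.lin := by
  have := continuous_barNorm
  unfold lin; fun_prop

theorem sq_add_sq_le_one {S : State} (hS : S ∈ stateSpace w) :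
    sigPlus S ^ 2 + 3 * barNorm S ^ 2 ≤ 1 := by
  obtain ⟨-, hT, hC, hK, -, -, hO⟩ := hS
  have h3 : √3 ^ 2 = (3 : ℝ) := Real.sq_sqrt (by norm_num)
  have hb : sigBar S ^ 2 = 3 * barNorm S ^ 2 := by rw [sigBar_eq, mul_pow, h3]
  have h : om S = 1 - (sigPlus S ^ 2 + sigBar S ^ 2 + sigTildeSq S + sigCheckSq S) - omK S := rfl
  linarith

/-- Cauchy–Schwarz: the linear form is one minus the inner product of a vector of length less than
one with a vector of length at most one. -/
theorem lin_pos (hW : W.normSq < 1) {S : State} (hS : S ∈ stateSpace w) : 0 < W.lin S := by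
  have h := sq_add_sq_le_one hS
  have h1 : (W.plus * sigPlus S + W.bar * barNorm S) ^ 2
      ≤ W.normSq * (sigPlus S ^ 2 + 3 * barNorm S ^ 2) := by
    unfold normSq
    nlinarith [sq_nonneg (3 * W.plus * barNorm S - W.bar * sigPlus S)]
  have h0 : 0 ≤ W.normSq := by unfold normSq; positivity
  have h2 : (W.plus * sigPlus S + W.bar * barNorm S) ^ 2 < 1 := by nlinarith
  have h3 := (abs_lt.1 ((sq_lt_one_iff_abs_lt_one _).1 h2)).2
  unfold lin; linarith

/-- Every factor contributes `-2 (2 - q)` times its exponent. The shear terms `-(2 - q) Σ₊` and `-(2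
- q) Σ̄` in the derivative of the linear form cancel this exactly because its power is `2 * total`.
-/
theorem hasDerivWithinAt_lyap (hW : W.normSq < 1) (hw : -1 < w) (hw' : w < 1) {γ : ℝ → State}
    {s : Set ℝ} {t : ℝ} (h : HasDerivWithinAt γ (field w (γ t)) s t) (hS : γ t ∈ sGen w) :
    HasDerivWithinAt (fun τ => W.lyap w (γ τ)) (W.lyapRate w (γ t)) s t := by
  obtain ⟨⟨hT, hC, hK, hv, hv', hO⟩, -⟩ := mem_sGen_iff.1 hS
  have hbox := stateSpace_subset_box hS.1
  have hg := gPlus_ne_zero_of_mem_box hw hbox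
  have hm := gMinus_ne_zero_of_mem_box hw' hbox
  have hl := (lin_pos hW hS.1).ne'
  have hG : HasDerivWithinAt (fun τ => gPlus w (γ τ))
      (w * (((1 - vSq (γ t)) * tiltRate w (γ t)) * vSq (γ t))) s t :=
    ((hasDerivWithinAt_vSq h).const_mul w).const_add 1
  have hL := (((hasDerivWithinAt_sigPlus h).const_mul W.plus).const_sub 1).sub
    ((hasDerivWithinAt_barNorm h).const_mul W.bar)
  have e : lyapRate W w (γ t)
      = W.tilde * (-2 * (2 - decel w (γ t) - 2 * √3 * sigBar (γ t)))
        + W.check * (-2 * (2 - decel w (γ t) - 3 * sigPlus (γ t) + √3 * sigBar (γ t)))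
        + W.curv * (2 * (decel w (γ t) - 4 * sigPlus (γ t)))
        + W.matter * (omRate w (γ t) + ((1 - w) / 2) * (-vSq (γ t) * tiltRate w (γ t))
          - w * (((1 - vSq (γ t)) * tiltRate w (γ t)) * vSq (γ t)) / gPlus w (γ t))
        - 2 * W.total * ((-(W.plus *
          (-(2 - decel w (γ t)) * sigPlus (γ t) - 3 * sigCheckSq (γ t) + 4 * omK (γ t)
            + (1 / 2) * (1 + w) * vSq (γ t) * fluid w (γ t)))
          - W.bar * (-(2 - decel w (γ t)) * barNorm (γ t) - 2 * sigTildeSq (γ t)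
            + sigCheckSq (γ t) + (1 / 2) * (1 + w) * vSq (γ t) * fluid w (γ t)))
          / W.lin (γ t)) := by
    -- The factor `(1 - v²)^((1-w)/2) / G₊` is chosen so that the tilt drops out of the growth rate
    -- of the matter density.
    have e1 : omRate w (γ t) + ((1 - w) / 2) * (-vSq (γ t) * tiltRate w (γ t))
        - w * (((1 - vSq (γ t)) * tiltRate w (γ t)) * vSq (γ t)) / gPlus w (γ t)
        = 2 * decel w (γ t) - (1 + 3 * w) := by
      have h2 : gPlus w (γ t) = 1 + w * vSq (γ t) := rfl
      have h3 : gMinus w (γ t) = 1 - w * vSq (γ t) := rfl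
      unfold omRate tiltRate
      field_simp
      rw [h2, h3]
      ring
    have h3 : √3 * sigBar (γ t) = 3 * barNorm (γ t) := by
      rw [sigBar_eq, ← mul_assoc, Real.mul_self_sqrt (by norm_num)]
    rw [e1, mul_assoc 2 (√3), h3]
    unfold lyapRate
    field_simp
    unfold lin total
    ring
  rw [e]
  have hsum := ((((((hasDerivWithinAt_sigTildeSq h).log hT.ne').const_mul W.tilde).add
    (((hasDerivWithinAt_sigCheckSq h).log hC.ne').const_mul W.check)).add
    (((hasDerivWithinAt_omK h).log hK.ne').const_mul W.curv)).add
    (((hasDerivWithinAt_om h hg).log hO.ne').const_mul W.matter)).add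
    (((hasDerivWithinAt_one_sub_vSq h).log hv'.ne').const_mul (W.matter * ((1 - w) / 2)))
  refine (hsum.add (((hG.log hg).const_mul (-W.matter)).sub
    ((hL.log hl).const_mul (2 * W.total)))).congr_deriv ?_
  have c : ∀ r z : ℝ, z ≠ 0 → r * z / z = r := fun r z hz => mul_div_cancel_right₀ r hz
  rw [c _ _ hT.ne', c _ _ hC.ne', c _ _ hK.ne', c _ _ hO.ne', c _ _ hv'.ne']
  change _ + (_ - 2 * W.total * (_ / W.lin (γ t))) = _
  ring

theorem continuousOn_lyapRate (hW : W.normSq < 1) (hw : -1 < w) :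
    ContinuousOn (W.lyapRate w) (stateSpace w) := by
  have h1 := (continuousOn_decel hw).mono (stateSpace_subset_box (w := w))
  have h2 := (continuousOn_fluid hw).mono (stateSpace_subset_box (w := w))
  have h3 := continuous_barNorm.continuousOn (s := stateSpace w)
  have h4 := (continuous_lin (W := W)).continuousOn (s := stateSpace w)
  unfold lyapRate
  refine ContinuousOn.sub (by fun_prop) (ContinuousOn.div (by fun_prop) h4
    fun S hS => (lin_pos hW hS).ne')

theorem continuousAt_lyap (hW : W.normSq < 1) (hw : -1 < w) {y : State} (hy : y ∈ stateSpace w)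
    (hT : 0 < sigTildeSq y) (hC : 0 < sigCheckSq y) (hK : 0 < omK y) (hO : 0 < om y)
    (hv : vSq y < 1) : ContinuousAt (W.lyap w) y := by
  have hg := gPlus_ne_zero_of_mem_box hw (stateSpace_subset_box hy)
  have c : ∀ f : State → ℝ, Continuous f → f y ≠ 0 → ContinuousAt (fun S => Real.log (f S)) y :=
    fun f hf h => hf.continuousAt.log h
  have h1 := c sigTildeSq (by fun_prop) hT.ne'
  have h2 := c sigCheckSq (by fun_prop) hC.ne'
  have h3 := c omK (by fun_prop) hK.ne'
  have h4 := c om continuous_om hO.ne'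
  have h5 := c (fun S => 1 - vSq S) (by fun_prop) (sub_pos.2 hv).ne'
  have h6 := c (gPlus w) (by unfold gPlus; fun_prop) hg
  have h7 := c W.lin continuous_lin (lin_pos hW hy).ne'
  unfold lyap
  fun_prop

end Weights

theorem exp_div_le_of_le_mul_log {e z B : ℝ} (he : 0 < e) (hz : 0 < z) (h : B ≤ e * Real.log z) :
    Real.exp (B / e) ≤ z := by
  rw [← Real.le_log_iff_exp_le hz, div_le_iff₀ he]
  linarith

/-- The monotonicity principle: what a monotone function tells about the future attractor. -/
theorem IsFutureOrbit.of_weights {w : ℝ} {x : State} {γ : ℝ → State} (hw : -1 < w) (hw' : w < 1)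
    (hx : x ∈ sGen w) (hγ : IsFutureOrbit w x γ) (W : Weights) (hW : W.normSq < 1)
    (ha : 0 ≤ W.tilde) (hb : 0 ≤ W.check) (hc : 0 ≤ W.curv) (hd : 0 ≤ W.matter) {N : ℝ}
    (hN : 0 < N) {rest : State → ℝ} (hrest : ∀ S ∈ stateSpace w, 0 ≤ rest S)
    (hid : ∀ S ∈ stateSpace w, W.lin S * W.lyapRate w S = N * W.dev S + rest S) :
    (∃ l, Tendsto (fun t => W.lyap w (γ t)) atTop (𝓝 l)) ∧
    ∀ y, MapClusterPt y atTop γ → y ∈ stateSpace w ∧ sigPlus y = W.plus ∧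
      barNorm y = W.bar / 3 ∧ rest y = 0 ∧
      (0 < W.tilde → 0 < sigTildeSq y) ∧ (0 < W.check → 0 < sigCheckSq y) ∧
      (0 < W.curv → 0 < omK y) ∧ (0 < W.matter → 0 < om y ∧ vSq y < 1) ∧
      (-(2 - decel w y) * sigPlus y - 3 * sigCheckSq y + 4 * omK y
        + (1 / 2) * (1 + w) * vSq y * fluid w y = 0) ∧
      (-(2 - decel w y) * barNorm y - 2 * sigTildeSq y + sigCheckSq y
        + (1 / 2) * (1 + w) * vSq y * fluid w y = 0) := by
  have hmem := hγ.mem_stateSpace hw hw' hx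
  have hgen := hγ.mem_sGen hw hw' hx
  have hder : ∀ t ∈ Ici (0 : ℝ),
      HasDerivWithinAt (fun τ => W.lyap w (γ τ)) (W.lyapRate w (γ t)) (Ici 0) t :=
    fun t ht => Weights.hasDerivWithinAt_lyap hW hw hw' (hγ.2 t ht) (hgen t ht)
  have hdev : ∀ S, 0 ≤ W.dev S := fun S => by
    have : 0 ≤ 1 - W.normSq := by linarith
    unfold Weights.dev; positivity
  have hrate : ∀ S ∈ stateSpace w, 0 ≤ W.lyapRate w S := by
    intro S hS
    have h1 := Weights.lin_pos hW hS
    have h2 := hid S hS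
    have h3 := hrest S hS
    have h4 := hdev S
    have : 0 ≤ W.lin S * W.lyapRate w S := by rw [h2]; positivity
    exact nonneg_of_mul_nonneg_right this h1
  -- `G₊` and the linear form are bounded away from zero, so their contribution is at most some `R`.
  -- All other logarithms are nonpositive, which bounds `lyap` above.
  obtain ⟨R, hR⟩ := ((isCompact_stateSpace hw).image_of_continuousOn
    (f := fun S => -W.matter * Real.log (gPlus w S) - 2 * W.total * Real.log (W.lin S)) (by
      have h1 : ContinuousOn (fun S => Real.log (gPlus w S)) (stateSpace w) :=
        ContinuousOn.log (by unfold gPlus; fun_prop) fun S hS =>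
          gPlus_ne_zero_of_mem_box hw (stateSpace_subset_box hS)
      have h2 : ContinuousOn (fun S => Real.log (W.lin S)) (stateSpace w) :=
        ContinuousOn.log Weights.continuous_lin.continuousOn fun S hS =>
          (Weights.lin_pos hW hS).ne'
      fun_prop)).bddAbove
  have hlog : ∀ t ∈ Ici (0 : ℝ), W.tilde * Real.log (sigTildeSq (γ t)) ≤ 0 ∧
      W.check * Real.log (sigCheckSq (γ t)) ≤ 0 ∧ W.curv * Real.log (omK (γ t)) ≤ 0 ∧
      W.matter * Real.log (om (γ t)) ≤ 0 ∧
      W.matter * ((1 - w) / 2) * Real.log (1 - vSq (γ t)) ≤ 0 ∧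
      -W.matter * Real.log (gPlus w (γ t)) - 2 * W.total * Real.log (W.lin (γ t)) ≤ R := by
    intro t ht
    obtain ⟨⟨hT, hC, hK, hv, hv', hO⟩, -⟩ := mem_sGen_iff.1 (hgen t ht)
    have hbx := mem_box_iff.1 (stateSpace_subset_box (hmem t ht))
    have hO1 : om (γ t) ≤ 1 := by
      have h := sq_nonneg (sigPlus (γ t))
      have h' := sq_nonneg (sigBar (γ t))
      unfold om sigSq; linarith
    have key : ∀ e z : ℝ, 0 ≤ e → 0 < z → z ≤ 1 → e * Real.log z ≤ 0 := fun e z he hz hz1 =>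
      mul_nonpos_of_nonneg_of_nonpos he (Real.log_nonpos hz.le hz1)
    have hw2 : 0 ≤ (1 - w) / 2 := by linarith
    exact ⟨key _ _ ha hT hbx.2.2.1.2, key _ _ hb hC hbx.2.2.2.1.2, key _ _ hc hK hbx.2.2.2.2.1.2,
      key _ _ hd hO hO1, key _ _ (by positivity) hv' (by linarith),
      hR (mem_image_of_mem _ (hmem t ht))⟩
  obtain ⟨hmono, l, hl⟩ := exists_tendsto_of_deriv_nonneg hder (fun t ht => hrate _ (hmem t ht))
    (B := R) (fun t ht => by
      obtain ⟨h1, h2, h3, h4, h5, h6⟩ := hlog t ht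
      unfold Weights.lyap; linarith)
  have hlow : ∀ t ∈ Ici (0 : ℝ), W.lyap w (γ 0) ≤ W.lyap w (γ t) := fun t ht =>
    hmono self_mem_Ici ht ht
  refine ⟨⟨l, hl⟩, ?_⟩
  have hz := tendsto_deriv_zero_of_tendsto hder
    (hγ.uniformContinuousOn_comp hw hw' hx (Weights.continuousOn_lyapRate hW hw)) hl
  have hcl : ∀ y, MapClusterPt y atTop γ →
      y ∈ stateSpace w ∧ sigPlus y = W.plus ∧ barNorm y = W.bar / 3 ∧ rest y = 0 := by
    intro y hy
    obtain ⟨hyS, hy0⟩ := eq_of_mapClusterPt (isClosed_stateSpace hw) hmem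
      (Weights.continuousOn_lyapRate hW hw) hz hy
    -- The rate vanishes at `y`, so two nonnegative terms sum to zero and both vanish.
    have h1 := hid y hyS
    rw [hy0, mul_zero] at h1
    have h2 := hrest y hyS
    have h3 : 0 ≤ N * W.dev y := mul_nonneg hN.le (hdev y)
    have h4 : W.dev y = 0 := by
      have : N * W.dev y = 0 := by linarith
      exact (mul_eq_zero.1 this).resolve_left hN.ne'
    have h5 : 0 < 1 - W.normSq := by linarith
    have h6 : (sigPlus y - W.plus) ^ 2 + 3 * (barNorm y - W.bar / 3) ^ 2 = 0 := by
      unfold Weights.dev at h4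
      have h7 := sq_nonneg (W.plus * (sigPlus y - W.plus) + W.bar * (barNorm y - W.bar / 3))
      have h8 : 0 ≤ (sigPlus y - W.plus) ^ 2 + 3 * (barNorm y - W.bar / 3) ^ 2 := by positivity
      nlinarith
    have h9 : (sigPlus y - W.plus) ^ 2 = 0 := by
      nlinarith [sq_nonneg (sigPlus y - W.plus), sq_nonneg (barNorm y - W.bar / 3)]
    have h10 : (barNorm y - W.bar / 3) ^ 2 = 0 := by
      nlinarith [sq_nonneg (sigPlus y - W.plus), sq_nonneg (barNorm y - W.bar / 3)]
    exact ⟨hyS, sub_eq_zero.1 (pow_eq_zero_iff two_ne_zero |>.1 h9),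
      sub_eq_zero.1 (pow_eq_zero_iff two_ne_zero |>.1 h10), by linarith⟩
  intro y hy
  obtain ⟨hyS, hyp, hyX, hyr⟩ := hcl y hy
  -- As all terms but one are bounded above, the initial value of `lyap` bounds each single term
  -- from below. A quantity with positive exponent thus stays away from zero.
  have hpos : ∀ (φ : State → ℝ) (e : ℝ), Continuous φ → 0 < e → (∀ t ∈ Ici (0 : ℝ), 0 < φ (γ t)) →
      (∀ t ∈ Ici (0 : ℝ), W.lyap w (γ 0) - R ≤ e * Real.log (φ (γ t))) → 0 < φ y := by
    intro φ e hφ he hp hlb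
    exact (Real.exp_pos _).trans_le (le_of_mapClusterPt hφ
      (fun t ht => exp_div_le_of_le_mul_log he (hp t ht) (hlb t ht)) hy)
  have hop : ∀ t ∈ Ici (0 : ℝ), γ t ∈ openPart := fun t ht => (mem_sGen_iff.1 (hgen t ht)).1
  have hlow' : ∀ t ∈ Ici (0 : ℝ), W.lyap w (γ 0) ≤
      W.tilde * Real.log (sigTildeSq (γ t)) + W.check * Real.log (sigCheckSq (γ t))
      + W.curv * Real.log (omK (γ t)) + W.matter * Real.log (om (γ t))
      + W.matter * ((1 - w) / 2) * Real.log (1 - vSq (γ t))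
      + (-W.matter * Real.log (gPlus w (γ t)) - 2 * W.total * Real.log (W.lin (γ t))) := hlow
  have hbS : stateSpace w ⊆ box := stateSpace_subset_box
  have k1 := (continuousOn_decel hw).mono hbS
  have k2 := (continuousOn_fluid hw).mono hbS
  have k3 := Weights.continuous_barNorm
  refine ⟨hyS, hyp, hyX, hyr, fun h => ?_, fun h => ?_, fun h => ?_, fun h => ⟨?_, ?_⟩, ?_, ?_⟩
  · refine hpos _ W.tilde (by fun_prop) h (fun t ht => (hop t ht).1) fun t ht => ?_
    have := hlow' t ht; have := hlog t ht; linarith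
  · refine hpos _ W.check (by fun_prop) h (fun t ht => (hop t ht).2.1) fun t ht => ?_
    have := hlow' t ht; have := hlog t ht; linarith
  · refine hpos _ W.curv (by fun_prop) h (fun t ht => (hop t ht).2.2.1) fun t ht => ?_
    have := hlow' t ht; have := hlog t ht; linarith
  · refine hpos _ W.matter continuous_om h (fun t ht => (hop t ht).2.2.2.2.2) fun t ht => ?_
    have := hlow' t ht; have := hlog t ht; linarith
  · have hw2 : 0 < (1 - w) / 2 := by linarith
    refine sub_pos.1 (hpos (fun S => 1 - vSq S) (W.matter * ((1 - w) / 2)) (by fun_prop)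
      (by positivity) (fun t ht => (hop t ht).2.2.2.2.1) fun t ht => ?_)
    have := hlow' t ht; have := hlog t ht; linarith
  · exact hγ.deriv_eq_zero_of_mapClusterPt hw hw' hx
      (φ := sigPlus) (ψ := fun y => -(2 - decel w y) * sigPlus y - 3 * sigCheckSq y + 4 * omK y
        + (1 / 2) * (1 + w) * vSq y * fluid w y) (by fun_prop) (by fun_prop)
      (fun t ht => hasDerivWithinAt_sigPlus (hγ.2 t ht)) (fun y _ hy => (hcl y hy).2.1) hy
  · exact hγ.deriv_eq_zero_of_mapClusterPt hw hw' hx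
      (φ := barNorm) (ψ := fun y => -(2 - decel w y) * barNorm y - 2 * sigTildeSq y
        + sigCheckSq y + (1 / 2) * (1 + w) * vSq y * fluid w y) (by fun_prop) (by fun_prop)
      (fun t ht => hasDerivWithinAt_barNorm (hγ.2 t ht)) (fun y _ hy => (hcl y hy).2.2.1) hy

end Lyapunov

/-! ### Relations at a cluster point and the choices of exponents -/

theorem eq_vec {y : State} {a b c d e f : ℝ} (h0 : sigPlus y = a) (h1 : sigBar y = b)
    (h2 : sigTildeSq y = c) (h3 : sigCheckSq y = d) (h4 : omK y = e) (h5 : vSq y = f) :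
    y = ![a, b, c, d, e, f] := by
  subst h0 h1 h2 h3 h4 h5
  funext i
  fin_cases i <;> rfl

/-- The relations that hold in the state space, in terms of `fluid`. -/
theorem stateSpace_relations {w : ℝ} (hw : -1 < w) {y : State} (hy : y ∈ stateSpace w) :
    0 ≤ fluid w y ∧ om y = fluid w y * (1 + w * vSq y) ∧
    sigPlus y ^ 2 + 3 * barNorm y ^ 2 + sigTildeSq y + sigCheckSq y + omK y
      + fluid w y * (1 + w * vSq y) = 1 ∧
    decel w y = 2 - 2 * omK y - (1 / 2) * fluid w y * (3 * (1 - w) + (5 * w - 1) * vSq y) ∧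
    4 * sigCheckSq y * omK y = (1 + w) ^ 2 * vSq y * fluid w y ^ 2 := by
  have hg := gPlus_pos hw hy.2.2.2.2.1 hy.2.2.2.2.2.1
  refine ⟨mul_nonneg (inv_nonneg.2 hg.le) hy.2.2.2.2.2.2, om_eq hg.ne', gauss_eq hg.ne',
    decel_eq hg.ne', ?_⟩
  have := codazzi_eq w y
  rw [hy.1] at this
  linarith

namespace Weights

/-- `lin * lyapRate` without division. -/
theorem lin_mul_lyapRate {W : Weights} (hW : W.normSq < 1) {w : ℝ} (hw : -1 < w) {S : State}
    (hS : S ∈ stateSpace w) : W.lin S * W.lyapRate w S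
      = W.lin S * (4 * (W.curv + W.matter) - (1 + 3 * w) * W.matter
          + (6 * W.check - 8 * W.curv) * sigPlus S + 6 * (2 * W.tilde - W.check) * barNorm S)
        - 2 * W.total * (2 * omK S
          + (1 / 2) * fluid w S * (3 * (1 - w) + (5 * w - 1) * vSq S)
          - W.plus * (-3 * sigCheckSq S + 4 * omK S + (1 / 2) * (1 + w) * vSq S * fluid w S)
          - W.bar * (-2 * sigTildeSq S + sigCheckSq S
            + (1 / 2) * (1 + w) * vSq S * fluid w S)) := by
  have hl := (lin_pos hW hS).ne'
  have hq := (stateSpace_relations hw hS).2.2.2.1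
  unfold lyapRate
  rw [mul_sub, mul_div_cancel₀ _ hl, hq]
  ring

/-- The exponents adapted to the Friedmann point. -/
def friedmann : Weights := ⟨0, 0, 0, 1, 0, 0⟩

/-- The exponents adapted to the Collins–Stewart point. -/
noncomputable def collinsStewart (w : ℝ) : Weights :=
  ⟨0, 0, (3 * w + 1) * (1 - w), 4 * (5 - w), (3 * w + 1) / 8, 0⟩

/-- The exponents adapted to Hewitt's point. -/
noncomputable def hewitt (w : ℝ) : Weights :=
  ⟨0, 7 * w - 3, 2 * (3 * w - 1), 8, (3 * w + 1) / 8, 3 * (7 * w - 3) / 8⟩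

/-- The exponents adapted to the extremely tilted point. -/
noncomputable def extreme : Weights := ⟨4, 10, 9, 0, 1 / 3, 1 / 3⟩

end Weights

/-! ### The positivity identities of the four monotone functions -/

section Cases

variable {w : ℝ} {x : State} {γ : ℝ → State}

theorem normSq_friedmann : Weights.friedmann.normSq < 1 := by
  norm_num [Weights.normSq, Weights.friedmann]

theorem normSq_collinsStewart (h1 : -1 / 3 < w) (h2 : w ≤ 3 / 7) :
    (Weights.collinsStewart w).normSq < 1 := by
  simp only [Weights.normSq, Weights.collinsStewart]
  nlinarith

theorem normSq_hewitt (h1 : 3 / 7 < w) (h2 : w < 1) : (Weights.hewitt w).normSq < 1 := by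
  simp only [Weights.normSq, Weights.hewitt]
  nlinarith

theorem normSq_extreme : Weights.extreme.normSq < 1 := by
  norm_num [Weights.normSq, Weights.extreme]

/-- As in the next three identities, the two sides differ by a multiple of the Gauss identity. The
form `dev` equals `lin² - (1 - |z|²)(1 - |z₀|²)`, where `z = (Σ₊, Σ̄)` and `|z₀|²` is `normSq`. -/
theorem friedmann_identity (hw : -1 < w) {S : State} (hS : S ∈ stateSpace w) :
    Weights.friedmann.lin S * Weights.friedmann.lyapRate w S
      = 3 * (1 - w) * Weights.friedmann.dev S
        + (3 * (1 - w) * (sigTildeSq S + sigCheckSq S) + (-1 - 3 * w) * omK S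
          + (1 - 3 * w) * (1 + w) * (vSq S * fluid w S)) := by
  obtain ⟨-, -, hG, -, -⟩ := stateSpace_relations hw hS
  rw [Weights.lin_mul_lyapRate normSq_friedmann hw hS]
  simp only [Weights.dev, Weights.normSq, Weights.total, Weights.lin, Weights.friedmann]
  linear_combination (-3 * (1 - w)) * hG

/-- The exponents of `Ω_k` and of the matter density are proportional to the values of `Ω_k` and `Ω`
at the point `CS`. -/
theorem collinsStewart_identity (hw : -1 < w) (h1 : -1 / 3 < w) (h2 : w ≤ 3 / 7) {S : State}
    (hS : S ∈ stateSpace w) :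
    (Weights.collinsStewart w).lin S * (Weights.collinsStewart w).lyapRate w S
      = 64 * (1 - w) * (Weights.collinsStewart w).dev S
        + 2 * (21 - 2 * w - 3 * w ^ 2) * (3 / 2 * (1 - w) * sigTildeSq S
          + 3 / 8 * (3 - 7 * w) * sigCheckSq S
          + 3 / 16 * (3 - 7 * w) * (1 + w) * (vSq S * fluid w S)) := by
  obtain ⟨-, -, hG, -, -⟩ := stateSpace_relations hw hS
  rw [Weights.lin_mul_lyapRate (normSq_collinsStewart h1 h2) hw hS]
  simp only [Weights.dev, Weights.normSq, Weights.total, Weights.lin, Weights.collinsStewart]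
  linear_combination (-3 * (1 - w) * (21 - 2 * w - 3 * w ^ 2)) * hG

/-- The exponents are proportional to `Σ̌² + δ/2`, `Ω_k + δ/2` and `Ω - δ` at `H`, where `δ = (1 +
w) v² Ω / G₊`. The shift by `δ` reflects the Codazzi relation between `Σ̌² Ω_k` and `v² (Ω / G₊)²`,
and no power of `v²` is needed. -/
theorem hewitt_identity (hw : -1 < w) (h1 : 3 / 7 < w) (h2 : w < 1) {S : State}
    (hS : S ∈ stateSpace w) :
    (Weights.hewitt w).lin S * (Weights.hewitt w).lyapRate w S
      = 16 * (Weights.hewitt w).dev S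
        + 3 / 2 * (13 * w + 3) * (5 - 9 * w) * sigTildeSq S := by
  obtain ⟨-, -, hG, -, -⟩ := stateSpace_relations hw hS
  rw [Weights.lin_mul_lyapRate (normSq_hewitt h1 h2) hw hS]
  simp only [Weights.dev, Weights.normSq, Weights.total, Weights.lin, Weights.hewitt]
  linear_combination (-3 * (1 - w) * (13 * w + 3)) * hG

/-- The same recipe at `Het`, where `δ = Ω`: the matter exponent vanishes and the exponents of
`Σ̃²`, `Σ̌²`, `Ω_k` are in the ratio `4 : 10 : 9`. -/
theorem extreme_identity (hw : -1 < w) {S : State} (hS : S ∈ stateSpace w) :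
    Weights.extreme.lin S * Weights.extreme.lyapRate w S
      = 36 * Weights.extreme.dev S + 23 / 3 * (9 * w - 5) * ((1 - vSq S) * fluid w S) := by
  obtain ⟨-, -, hG, -, -⟩ := stateSpace_relations hw hS
  rw [Weights.lin_mul_lyapRate normSq_extreme hw hS]
  simp only [Weights.dev, Weights.normSq, Weights.total, Weights.lin, Weights.extreme]
  linear_combination (-92 / 3) * hG

/-! ### Convergence to the isolated fixed points -/

theorem IsFutureOrbit.omegaSet_eq_ptF (hw : -1 < w) (hw' : w < 1) (hx : x ∈ sGen w)
    (hγ : IsFutureOrbit w x γ) (h : w ≤ -1 / 3) : omegaSet γ = {ptF} := by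
  have hmain := (hγ.of_weights hw hw' hx Weights.friedmann normSq_friedmann le_rfl le_rfl le_rfl
    zero_le_one (show 0 < 3 * (1 - w) by linarith)
    (fun S hS => by
      have h1 := (stateSpace_relations hw hS).1
      obtain ⟨-, hT, hC, hK, hv, -, -⟩ := hS
      have h2 : 0 ≤ 1 - w := by linarith
      have h3 : 0 ≤ -1 - 3 * w := by linarith
      have h4 : 0 ≤ 1 - 3 * w := by linarith
      have h5 : 0 ≤ 1 + w := by linarith
      positivity)
    (fun S hS => friedmann_identity hw hS)).2
  refine hγ.omegaSet_eq_singleton hw hw' hx fun y hy => ?_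
  obtain ⟨hyS, hp, hX, hr, -, -, -, hpos, e1, -⟩ := hmain y hy
  obtain ⟨hU, hOU, -, -, -⟩ := stateSpace_relations hw hyS
  obtain ⟨hO, hv1⟩ := hpos one_pos
  obtain ⟨-, hT, hC, hK, hv, -, -⟩ := hyS
  simp only [Weights.friedmann, zero_div] at hp hX
  have hUpos : 0 < fluid w y := hU.lt_of_ne' fun h0 => by
    rw [hOU, h0, zero_mul] at hO; exact hO.false
  have a1 : 0 ≤ vSq y * fluid w y := by positivity
  have a2 : 0 < (1 - 3 * w) * (1 + w) := mul_pos (by linarith) (by linarith)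
  have a3 : 0 ≤ (-1 - 3 * w) * omK y := mul_nonneg (by linarith) hK
  have a4 : 0 ≤ (1 - 3 * w) * (1 + w) * (vSq y * fluid w y) := mul_nonneg a2.le a1
  have a5 : 0 ≤ 3 * (1 - w) * (sigTildeSq y + sigCheckSq y) :=
    mul_nonneg (by linarith) (by linarith)
  have a6 : 3 * (1 - w) * (sigTildeSq y + sigCheckSq y) = 0 := by linarith
  have a7 : sigTildeSq y + sigCheckSq y = 0 :=
    (mul_eq_zero.1 a6).resolve_left (by linarith)
  have a8 : vSq y * fluid w y = 0 :=
    (mul_eq_zero.1 (show (1 - 3 * w) * (1 + w) * (vSq y * fluid w y) = 0 by linarith)).resolve_left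
      a2.ne'
  have hT0 : sigTildeSq y = 0 := by linarith
  have hC0 : sigCheckSq y = 0 := by linarith
  have hv0 : vSq y = 0 := (mul_eq_zero.1 a8).resolve_right hUpos.ne'
  refine eq_vec hp ?_ hT0 hC0 ?_ hv0
  · rw [sigBar_eq, hX, mul_zero]
  -- At `w = -1/3` the remainder says nothing about `Ω_k`; the stationarity of `Σ₊` covers all
  -- cases.
  · rw [hp, hC0, hv0] at e1
    linarith

theorem IsFutureOrbit.omegaSet_eq_ptCS (hw : -1 < w) (hw' : w < 1) (hx : x ∈ sGen w)
    (hγ : IsFutureOrbit w x γ) (h1 : -1 / 3 < w) (h2 : w ≤ 3 / 7) : omegaSet γ = {ptCS w} := by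
  have hn : 0 < 21 - 2 * w - 3 * w ^ 2 := by nlinarith
  have hmain := (hγ.of_weights hw hw' hx (Weights.collinsStewart w) (normSq_collinsStewart h1 h2)
    le_rfl le_rfl
    (show 0 ≤ (3 * w + 1) * (1 - w) from mul_nonneg (by linarith) (by linarith))
    (show 0 ≤ 4 * (5 - w) by linarith) (show 0 < 64 * (1 - w) by linarith)
    (fun S hS => by
      have h1 := (stateSpace_relations hw hS).1
      obtain ⟨-, hT, hC, hK, hv, -, -⟩ := hS
      have h2 : 0 ≤ 1 - w := by linarith
      have h3 : 0 ≤ 3 - 7 * w := by linarith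
      have h5 : 0 ≤ 1 + w := by linarith
      positivity)
    (fun S hS => collinsStewart_identity hw h1 h2 hS)).2
  refine hγ.omegaSet_eq_singleton hw hw' hx fun y hy => ?_
  obtain ⟨hyS, hp, hX, hr, -, -, -, hpos, e1, e2⟩ := hmain y hy
  obtain ⟨hU, hOU, hG, hq, -⟩ := stateSpace_relations hw hyS
  obtain ⟨hO, hv1⟩ := hpos (show 0 < 4 * (5 - w) by linarith)
  obtain ⟨-, hT, hC, hK, hv, -, -⟩ := hyS
  simp only [Weights.collinsStewart, zero_div] at hp hX
  have hUpos : 0 < fluid w y := hU.lt_of_ne' fun h0 => by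
    rw [hOU, h0, zero_mul] at hO; exact hO.false
  have a1 : 0 ≤ vSq y * fluid w y := by positivity
  have a2 : 0 ≤ 3 / 8 * (3 - 7 * w) * sigCheckSq y := mul_nonneg (by linarith) hC
  have a3 : 0 ≤ 3 / 16 * (3 - 7 * w) * (1 + w) * (vSq y * fluid w y) :=
    mul_nonneg (mul_nonneg (by linarith) (by linarith)) a1
  have a4 : 0 ≤ 3 / 2 * (1 - w) * sigTildeSq y := mul_nonneg (by linarith) hT
  have a5 := (mul_eq_zero.1 hr).resolve_left (by linarith)
  have hT0 : sigTildeSq y = 0 :=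
    (mul_eq_zero.1 (show 3 / 2 * (1 - w) * sigTildeSq y = 0 by linarith)).resolve_left
      (by linarith)
  -- At `w = 3/7` the remainder controls only `Σ̃²`. The stationarity of `Σ̄` still gives a
  -- vanishing sum of nonnegative terms in `Σ̌²` and `v²`.
  rw [hX, hT0] at e2
  have a6 : 0 ≤ (1 / 2) * (1 + w) * (vSq y * fluid w y) := mul_nonneg (by linarith) a1
  have hC0 : sigCheckSq y = 0 := by linarith
  have a7 : vSq y * fluid w y = 0 :=
    (mul_eq_zero.1 (show (1 / 2) * (1 + w) * (vSq y * fluid w y) = 0 by linarith)).resolve_left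
      (by linarith)
  have hv0 : vSq y = 0 := (mul_eq_zero.1 a7).resolve_right hUpos.ne'
  refine eq_vec hp ?_ hT0 hC0 ?_ hv0
  · rw [sigBar_eq, hX, mul_zero]
  · rw [hp, hX, hT0, hC0, hv0] at hG
    rw [hp, hC0, hv0, hq, hv0] at e1
    have hU0 : fluid w y = 1 - ((3 * w + 1) / 8) ^ 2 - omK y := by linarith
    rw [hU0] at e1
    have hfac : 4 * (1 - ((3 * w + 1) / 8) ^ 2) *
        (omK y - 3 / 64 * (3 * w + 1) * (1 - w)) = 0 := by
      linear_combination e1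
    exact sub_eq_zero.1 ((mul_eq_zero.1 hfac).resolve_left (by nlinarith))

theorem IsFutureOrbit.omegaSet_eq_ptH (hw : -1 < w) (hw' : w < 1) (hx : x ∈ sGen w)
    (hγ : IsFutureOrbit w x γ) (h1 : 3 / 7 < w) (h2 : w < 5 / 9) : omegaSet γ = {ptH w} := by
  have hmain := (hγ.of_weights hw hw' hx (Weights.hewitt w) (normSq_hewitt h1 hw') le_rfl
    (show 0 ≤ 7 * w - 3 by linarith) (show 0 ≤ 2 * (3 * w - 1) by linarith)
    (show (0 : ℝ) ≤ 8 by norm_num) (show (0 : ℝ) < 16 by norm_num)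
    (fun S hS => mul_nonneg (mul_nonneg (by linarith) (by linarith)) hS.2.1)
    (fun S hS => hewitt_identity hw h1 hw' hS)).2
  refine hγ.omegaSet_eq_singleton hw hw' hx fun y hy => ?_
  obtain ⟨hyS, hp, hX, hr, -, hCpos, hKpos, hpos, e1, e2⟩ := hmain y hy
  obtain ⟨hU, hOU, hG, hq, hcod⟩ := stateSpace_relations hw hyS
  obtain ⟨hO, hv1⟩ := hpos (show (0 : ℝ) < 8 by norm_num)
  replace hCpos := hCpos (show 0 < 7 * w - 3 by linarith)
  replace hKpos := hKpos (show 0 < 2 * (3 * w - 1) by linarith)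
  obtain ⟨-, hT, hC, hK, hv, -, -⟩ := hyS
  simp only [Weights.hewitt] at hp hX
  have hUpos : 0 < fluid w y := hU.lt_of_ne' fun h0 => by
    rw [hOU, h0, zero_mul] at hO; exact hO.false
  have hT0 : sigTildeSq y = 0 :=
    (mul_eq_zero.1 hr).resolve_left (mul_pos (by linarith) (by linarith)).ne'
  have hXb : sigBar y = √3 / 8 * (7 * w - 3) := by rw [sigBar_eq, hX]; ring
  -- With `V = v² Ω / G₊` as an unknown, the Gauss relation is linear in `Σ̌²`, `Ω_k`, `Ω / G₊` and
  -- `V`, and so are both stationarity equations.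
  generalize hVdef : vSq y * fluid w y = V at *
  have hvU : ∀ z : ℝ, z * vSq y * fluid w y = z * V := fun z => by rw [mul_assoc, hVdef]
  have hG' : ((3 * w + 1) / 8) ^ 2 + 3 * (3 * (7 * w - 3) / 8 / 3) ^ 2 + sigCheckSq y + omK y
      + fluid w y + w * V = 1 := by
    rw [hp, hX, hT0] at hG
    linear_combination hG - w * hVdef
  rw [hp, hvU] at e1
  rw [hX, hT0, hvU] at e2
  have hQ : 2 - decel w y = 2 * omK y + (1 / 2) * (3 * (1 - w) * fluid w y + (5 * w - 1) * V) := by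
    rw [hq]; linear_combination ((5 * w - 1) / 2) * hVdef
  rw [hQ] at e1 e2
  generalize fluid w y = U at *
  generalize hCdef : sigCheckSq y = C at *
  generalize hKdef : omK y = K at *
  have hm : 0 < 3 * (1 - w) * (13 * w + 3) / 16 := by
    have : 0 < (1 - w) * (13 * w + 3) := mul_pos (by linarith) (by linarith)
    linarith
  -- Pairing the stationarity equations with the shear vector and adding the Gauss relation isolates
  -- `2 - q`, with the factor `1 - normSq`, which is the positive number of `hm`.
  have hq' : 2 * K + (1 / 2) * (3 * (1 - w) * U + (5 * w - 1) * V) = 3 / 2 * (1 - w) := by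
    have : 3 * (1 - w) * (13 * w + 3) / 16 *
        (2 * K + (1 / 2) * (3 * (1 - w) * U + (5 * w - 1) * V) - 3 / 2 * (1 - w)) = 0 := by
      linear_combination ((3 * w + 1) / 8) * e1 + (3 * (7 * w - 3) / 8) * e2
        + (3 / 2 * (1 - w)) * hG'
    exact sub_eq_zero.1 ((mul_eq_zero.1 this).resolve_left hm.ne')
  rw [hq'] at e1 e2
  have hCV : C = 3 / 16 * (1 - w) * (7 * w - 3) - 1 / 2 * (1 + w) * V := by
    linear_combination e2
  have hKV : K = 3 / 8 * (1 - w) * (3 * w - 1) - 1 / 2 * (1 + w) * V := by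
    linear_combination (1 / 4) * e1 + (3 / 4) * e2
  have hUV : U = 3 / 2 * (1 - w) + V := by
    linear_combination hG' - hCV - hKV
  -- The terms in `V²` cancel in the Codazzi relation, which leaves a linear equation for `V`.
  have hV : (1 + w) * (17 * w - 1) * V = 3 / 4 * (1 - w) * (7 * w - 3) * (3 * w - 1) := by
    have : 3 / 8 * (1 - w) * ((1 + w) * (17 * w - 1) * V
        - 3 / 4 * (1 - w) * (7 * w - 3) * (3 * w - 1)) = 0 := by
      have h : 4 * C * K = (1 + w) ^ 2 * V * U := by
        rw [hcod]; linear_combination (1 + w) ^ 2 * U * hVdef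
      rw [hCV, hKV, hUV] at h
      linear_combination -h
    exact sub_eq_zero.1 ((mul_eq_zero.1 this).resolve_left (by linarith))
  have hU' : (1 + w) * (17 * w - 1) * U = 3 / 4 * (1 - w) * (11 * w + 1) * (5 * w + 1) := by
    rw [hUV]; linear_combination hV
  have h17 : 17 * w - 1 ≠ 0 := by linarith
  have h11 : 11 * w + 1 ≠ 0 := by linarith
  have h5 : 5 * w + 1 ≠ 0 := by linarith
  refine eq_vec hp hXb hT0 (hCdef.trans ?_) (hKdef.trans ?_) ?_
  · rw [eq_div_iff (mul_ne_zero (by norm_num) h17)]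
    linear_combination 16 * (17 * w - 1) * hCV - 8 * hV
  · rw [eq_div_iff (mul_ne_zero (by norm_num) h17)]
    linear_combination 4 * (17 * w - 1) * hKV - 2 * hV
  · rw [eq_div_iff (mul_ne_zero h11 h5)]
    have : 3 / 4 * (1 - w) * (vSq y * ((11 * w + 1) * (5 * w + 1)) - (3 * w - 1) * (7 * w - 3))
        = 0 := by
      linear_combination (-vSq y) * hU' + hV + (1 + w) * (17 * w - 1) * hVdef
    exact sub_eq_zero.1 ((mul_eq_zero.1 this).resolve_left (by linarith))

theorem sqrt_three_mul_ninth : √3 * (1 / 3 / 3) = 1 / (3 * √3) := by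
  have h3 : √3 ^ 2 = (3 : ℝ) := Real.sq_sqrt (by norm_num)
  rw [eq_div_iff (by positivity)]
  linear_combination (1 / 3) * h3

theorem IsFutureOrbit.omegaSet_eq_ptHet (hw : -1 < w) (hw' : w < 1) (hx : x ∈ sGen w)
    (hγ : IsFutureOrbit w x γ) (h : 5 / 9 < w) : omegaSet γ = {ptHet} := by
  have hmain := (hγ.of_weights hw hw' hx Weights.extreme normSq_extreme
    (show (0 : ℝ) ≤ 4 by norm_num) (show (0 : ℝ) ≤ 10 by norm_num)
    (show (0 : ℝ) ≤ 9 by norm_num) le_rfl (show (0 : ℝ) < 36 by norm_num)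
    (fun S hS => mul_nonneg (by linarith) (mul_nonneg (by linarith [hS.2.2.2.2.2.1])
      (stateSpace_relations hw hS).1))
    (fun S hS => extreme_identity hw hS)).2
  refine hγ.omegaSet_eq_singleton hw hw' hx fun y hy => ?_
  obtain ⟨hyS, hp, hX, hr, hTpos, hCpos, hKpos, -, e1, e2⟩ := hmain y hy
  obtain ⟨hU, hOU, hG, hq, hcod⟩ := stateSpace_relations hw hyS
  replace hCpos := hCpos (show (0 : ℝ) < 10 by norm_num)
  replace hKpos := hKpos (show (0 : ℝ) < 9 by norm_num)
  simp only [Weights.extreme] at hp hX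
  -- The matter exponent is zero here, so positivity of the matter comes from the Codazzi relation
  -- instead.
  have hUpos : 0 < fluid w y := hU.lt_of_ne' fun h0 => by
    rw [h0] at hcod
    have : 0 < 4 * sigCheckSq y * omK y := by positivity
    rw [hcod] at this
    simp at this
  have hv : vSq y = 1 := by
    have h2 := (mul_eq_zero.1 hr).resolve_left (by linarith)
    have h3 := (mul_eq_zero.1 h2).resolve_right hUpos.ne'
    linarith
  have hXb : sigBar y = 1 / (3 * √3) := by rw [sigBar_eq, hX, sqrt_three_mul_ninth]
  rw [hv] at hq hG hcod e1 e2
  rw [hp, hX] at hG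
  rw [hp, hq] at e1
  rw [hX, hq] at e2
  generalize hY : (1 + w) * fluid w y = Y at *
  have hYpos : 0 < Y := by rw [← hY]; exact mul_pos (by linarith) hUpos
  generalize hCdef : sigCheckSq y = C at *
  generalize hKdef : omK y = K at *
  generalize hTdef : sigTildeSq y = T at *
  generalize fluid w y = U at *
  have l1 : 20 * K - 18 * C + Y = 0 := by linear_combination 6 * e1 - hY
  have l2 : -4 * K - 36 * T + 18 * C + 7 * Y = 0 := by linear_combination 18 * e2 - 7 * hY
  have l3 : 4 * C * K = Y ^ 2 := by rw [hcod, ← hY]; ring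
  have l4 : T + C + K + Y = 23 / 27 := by linear_combination hG - hY
  -- Eliminating `Σ̌²` from the Codazzi relation leaves a quadratic form in `K` and `Y` that
  -- factors; the second factor is positive.
  have l5 : (20 * K - 9 * Y) * (2 * K + Y) = 0 := by
    linear_combination 9 * l3 + 2 * K * l1
  have l6 := (mul_eq_zero.1 l5).resolve_right (by linarith)
  refine eq_vec hp hXb (hTdef.trans ?_) (hCdef.trans ?_) (hKdef.trans ?_) hv <;> linarith

/-! ### The line of fixed points at `w = 5/9` -/

/-- On the line `HL` the cluster points of an orbit are determined by their `Σ̃²` coordinate. -/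
theorem hewitt_line_relations {y : State} (hyS : y ∈ stateSpace (5 / 9))
    (hp : sigPlus y = 1 / 3) (hX : barNorm y = 1 / 3 / 3)
    (hT : 0 < sigTildeSq y) (hC : 0 < sigCheckSq y) (hK : 0 < omK y) (hO : 0 < om y)
    (hv1 : vSq y < 1)
    (e1 : -(2 - decel (5 / 9) y) * sigPlus y - 3 * sigCheckSq y + 4 * omK y
        + (1 / 2) * (1 + 5 / 9) * vSq y * fluid (5 / 9) y = 0)
    (e2 : -(2 - decel (5 / 9) y) * barNorm y - 2 * sigTildeSq y + sigCheckSq y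
        + (1 / 2) * (1 + 5 / 9) * vSq y * fluid (5 / 9) y = 0) :
    ∃ b : ℝ, 0 < b ∧ b < 1 ∧ y = ptHL b ∧
      fluid (5 / 9) y = 2 * (17 - 8 * b) * (8 - 3 * b) / 399 := by
  obtain ⟨hU, hOU, hG, hq, hcod⟩ := stateSpace_relations (by norm_num) hyS
  have hUpos : 0 < fluid (5 / 9) y := hU.lt_of_ne' fun h0 => by
    rw [hOU, h0, zero_mul] at hO; exact hO.false
  have hXb : sigBar y = 1 / (3 * √3) := by rw [sigBar_eq, hX, sqrt_three_mul_ninth]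
  rw [hp, hX] at hG
  rw [hp, hq] at e1
  rw [hX, hq] at e2
  obtain ⟨b, hb⟩ : ∃ b, sigTildeSq y = 4 / 27 * b := ⟨27 / 4 * sigTildeSq y, by ring⟩
  have hbpos : 0 < b := by linarith
  generalize hV : vSq y * fluid (5 / 9) y = V at *
  have hUV : 6 * fluid (5 / 9) y = 36 * omK y + 34 * V - 12 * b := by
    linear_combination (-27 / 2) * e1 - (81 / 2) * e2 - 81 * hb + 34 * hV
  have hCV : sigCheckSq y = (18 * omK y - 7 * V + 4 * b) / 27 := by
    linear_combination (-1 / 3) * e1 - (1 / 81) * hUV + (13 / 81) * hV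
  have hVK : V = (1 + 2 * b - 9 * omK y) / 7 := by
    linear_combination (1 / 161) * (27 * hG - 27 * hb - 27 * hCV - (9 / 2) * hUV - 15 * hV)
  have hCK : sigCheckSq y = (27 * omK y - 1 + 2 * b) / 27 := by rw [hCV, hVK]; ring
  have hUK : fluid (5 / 9) y = (17 - 8 * b - 27 * omK y) / 21 := by
    linear_combination (1 / 6) * hUV + (17 / 3) * hVK
  -- The terms in `Ω_k²` cancel in the Codazzi relation, so `Ω_k` is determined by `b`.
  have hKb : omK y = (2 * b + 1) * (17 - 8 * b) / 171 := by
    have h : 81 * (sigCheckSq y * omK y) = 49 * (fluid (5 / 9) y * V) := by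
      linear_combination (81 / 4) * hcod + 49 * fluid (5 / 9) y * hV
    rw [hCK, hUK, hVK] at h
    linear_combination (1 / 57) * h
  have hCb : sigCheckSq y = 4 * (4 * b + 1) * (8 - 3 * b) / 513 := by rw [hCK, hKb]; ring
  have hUb : fluid (5 / 9) y = 2 * (17 - 8 * b) * (8 - 3 * b) / 399 := by rw [hUK, hKb]; ring
  have hVb : V = 2 * (2 * b + 1) * (4 * b + 1) / 133 := by rw [hVK, hKb]; ring
  have h17 : 0 < 17 - 8 * b := by
    have h : 0 < (2 * b + 1) * (17 - 8 * b) := by linarith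
    exact pos_of_mul_pos_right h (by linarith)
  have h8 : 0 < 8 - 3 * b := by
    have h : 0 < (4 * b + 1) * (8 - 3 * b) := by linarith
    exact pos_of_mul_pos_right h (by linarith)
  have hvb : vSq y = 3 * (4 * b + 1) * (2 * b + 1) / ((17 - 8 * b) * (8 - 3 * b)) := by
    rw [eq_div_iff (by positivity)]
    rw [hUb, hVb] at hV
    linear_combination (399 / 2) * hV
  refine ⟨b, hbpos, ?_, eq_vec hp hXb hb hCb hKb hvb, hUb⟩
  -- The bound `b < 1` is equivalent to `v² < 1`, since `1 - v²` is a positive multiple of `1 - b`.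
  rw [hvb, div_lt_one (by positivity)] at hv1
  linarith

/-- The value of the limit of the monotone functions at a point of the line `HL`, up to a constant,
as a function of the parameter. -/
noncomputable def lineInvariant (b : ℝ) : ℝ :=
  -4 * Real.log b - 8 * Real.log (4 * b + 1) + 6 * Real.log (8 - 3 * b)
    - 6 * Real.log (2 * b + 1) + 8 * Real.log (17 - 8 * b) + 4 * Real.log (1 - b)

theorem lineInvariant_lt {b b' : ℝ} (h0 : 0 < b) (h : b < b') (h1 : b' < 1) :
    lineInvariant b' < lineInvariant b := by
  have l1 := Real.log_lt_log h0 h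
  have l2 := Real.log_lt_log (show 0 < 4 * b + 1 by linarith)
    (show 4 * b + 1 < 4 * b' + 1 by linarith)
  have l3 := Real.log_lt_log (show 0 < 8 - 3 * b' by linarith)
    (show 8 - 3 * b' < 8 - 3 * b by linarith)
  have l4 := Real.log_lt_log (show 0 < 2 * b + 1 by linarith)
    (show 2 * b + 1 < 2 * b' + 1 by linarith)
  have l5 := Real.log_lt_log (show 0 < 17 - 8 * b' by linarith)
    (show 17 - 8 * b' < 17 - 8 * b by linarith)
  have l6 := Real.log_lt_log (show 0 < 1 - b' by linarith) (show 1 - b' < 1 - b by linarith)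
  unfold lineInvariant
  linarith

theorem lineInvariant_injOn : InjOn lineInvariant (Ioo 0 1) := by
  intro b hb b' hb' h
  rcases lt_trichotomy b b' with hlt | heq | hlt
  · exact absurd h (lineInvariant_lt hb.1 hlt hb'.2).ne'
  · exact heq
  · exact absurd h (lineInvariant_lt hb'.1 hlt hb.2).ne

/-- At `w = 5/9` both linear forms coincide, and the factor `9/4` equalizes the total exponents
`92/9` and `23`. The denominators therefore cancel and only logarithms of factors linear in `b`
remain. -/
theorem lyap_sub_lyap_ptHL {b : ℝ} (h0 : 0 < b) (h1 : b < 1)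
    (hU : fluid (5 / 9) (ptHL b) = 2 * (17 - 8 * b) * (8 - 3 * b) / 399)
    (hO : 0 < om (ptHL b)) (hG : 0 < gPlus (5 / 9) (ptHL b)) :
    9 / 4 * (Weights.hewitt (5 / 9)).lyap (5 / 9) (ptHL b) - Weights.extreme.lyap (5 / 9) (ptHL b)
      = lineInvariant b + (-4 * Real.log (4 / 27) - 8 * Real.log (4 / 513)
        - 6 * Real.log (1 / 171) + 18 * Real.log (2 / 399) + 4 * Real.log 133) := by
  have p2 : 0 < 4 * b + 1 := by linarith
  have p3 : 0 < 8 - 3 * b := by linarith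
  have p4 : 0 < 2 * b + 1 := by linarith
  have p5 : 0 < 17 - 8 * b := by linarith
  have p6 : 0 < 1 - b := by linarith
  have hlin : (Weights.hewitt (5 / 9)).lin (ptHL b) = Weights.extreme.lin (ptHL b) := by
    simp only [Weights.lin, Weights.hewitt, Weights.extreme]; norm_num
  have hT : Real.log (sigTildeSq (ptHL b)) = Real.log (4 / 27) + Real.log b := by
    rw [← Real.log_mul (by norm_num) h0.ne']; rfl
  have hC : Real.log (sigCheckSq (ptHL b))
      = Real.log (4 / 513) + Real.log (4 * b + 1) + Real.log (8 - 3 * b) := by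
    rw [← Real.log_mul (by norm_num) p2.ne', ← Real.log_mul (by positivity) p3.ne']
    congr 1
    show 4 * (4 * b + 1) * (8 - 3 * b) / 513 = _
    ring
  have hK : Real.log (omK (ptHL b))
      = Real.log (1 / 171) + Real.log (2 * b + 1) + Real.log (17 - 8 * b) := by
    rw [← Real.log_mul (by norm_num) p4.ne', ← Real.log_mul (by positivity) p5.ne']
    congr 1
    show (2 * b + 1) * (17 - 8 * b) / 171 = _
    ring
  have hv : Real.log (1 - vSq (ptHL b))
      = Real.log 133 + Real.log (1 - b) - (Real.log (17 - 8 * b) + Real.log (8 - 3 * b)) := by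
    rw [← Real.log_mul (by norm_num) p6.ne', ← Real.log_mul p5.ne' p3.ne',
      ← Real.log_div (by positivity) (by positivity)]
    congr 1
    show 1 - 3 * (4 * b + 1) * (2 * b + 1) / ((17 - 8 * b) * (8 - 3 * b)) = _
    have hne := mul_ne_zero p5.ne' p3.ne'
    rw [eq_div_iff hne, sub_mul, div_mul_cancel₀ _ hne]
    ring
  have hUl : Real.log (om (ptHL b)) - Real.log (gPlus (5 / 9) (ptHL b))
      = Real.log (2 / 399) + Real.log (17 - 8 * b) + Real.log (8 - 3 * b) := by
    rw [← Real.log_div hO.ne' hG.ne', ← Real.log_mul (by norm_num) p5.ne',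
      ← Real.log_mul (by positivity) p3.ne']
    congr 1
    rw [div_eq_inv_mul]
    refine hU.trans ?_
    ring
  unfold Weights.lyap lineInvariant
  rw [hlin, hT, hC, hK, hv]
  simp only [Weights.total, Weights.hewitt, Weights.extreme]
  linear_combination 18 * hUl

/-- Both remainders have the factor `9w - 5` up to sign, so here both functions are monotone. The
first keeps `Ω` and `1 - v²` from vanishing in the limit, the second `Σ̃²`; together they keep
cluster points off the ends of the line. -/
theorem IsFutureOrbit.exists_omegaSet_eq_ptHL (hx : x ∈ sGen (5 / 9))
    (hγ : IsFutureOrbit (5 / 9) x γ) :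
    ∃ b : ℝ, 0 < b ∧ b < 1 ∧ omegaSet γ = {ptHL b} := by
  have hw : (-1 : ℝ) < 5 / 9 := by norm_num
  have hw' : (5 / 9 : ℝ) < 1 := by norm_num
  have h37 : (3 / 7 : ℝ) < 5 / 9 := by norm_num
  have hn := normSq_hewitt h37 hw'
  obtain ⟨⟨l₁, hl₁⟩, hmain₁⟩ := hγ.of_weights hw hw' hx (Weights.hewitt (5 / 9)) hn le_rfl
    (show (0 : ℝ) ≤ 7 * (5 / 9) - 3 by norm_num) (show (0 : ℝ) ≤ 2 * (3 * (5 / 9) - 1) by norm_num)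
    (show (0 : ℝ) ≤ 8 by norm_num) (show (0 : ℝ) < 16 by norm_num)
    (fun S hS => mul_nonneg (by norm_num) hS.2.1) (fun S hS => hewitt_identity hw h37 hw' hS)
  obtain ⟨⟨l₂, hl₂⟩, hmain₂⟩ := hγ.of_weights hw hw' hx Weights.extreme normSq_extreme
    (show (0 : ℝ) ≤ 4 by norm_num) (show (0 : ℝ) ≤ 10 by norm_num)
    (show (0 : ℝ) ≤ 9 by norm_num) le_rfl (show (0 : ℝ) < 36 by norm_num)
    (fun S hS => by norm_num) (fun S hS => extreme_identity hw hS)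
  have key : ∀ y, MapClusterPt y atTop γ → ∃ b : ℝ, 0 < b ∧ b < 1 ∧ y = ptHL b ∧
      lineInvariant b + (-4 * Real.log (4 / 27) - 8 * Real.log (4 / 513)
        - 6 * Real.log (1 / 171) + 18 * Real.log (2 / 399) + 4 * Real.log 133)
        = 9 / 4 * l₁ - l₂ := by
    intro y hy
    obtain ⟨hyS, -, -, -, -, -, -, hpos, -, -⟩ := hmain₁ y hy
    obtain ⟨-, hp, hX, -, hT, hC, hK, -, e1, e2⟩ := hmain₂ y hy
    obtain ⟨hO, hv⟩ := hpos (show (0 : ℝ) < 8 by norm_num)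
    replace hT := hT (show (0 : ℝ) < 4 by norm_num)
    replace hC := hC (show (0 : ℝ) < 10 by norm_num)
    replace hK := hK (show (0 : ℝ) < 9 by norm_num)
    obtain ⟨b, h0, h1, rfl, hU⟩ := hewitt_line_relations hyS hp hX hT hC hK hO hv e1 e2
    refine ⟨b, h0, h1, rfl, ?_⟩
    -- Both functions are continuous at `y`, so their values there are the limits `l₁` and `l₂`, the
    -- same for every cluster point.
    rw [← lyap_sub_lyap_ptHL h0 h1 hU hO (gPlus_pos hw hyS.2.2.2.2.1 hyS.2.2.2.2.2.1),
      eq_of_mapClusterPt_of_continuousAt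
        (Weights.continuousAt_lyap hn hw hyS hT hC hK hO hv) hl₁ hy,
      eq_of_mapClusterPt_of_continuousAt
        (Weights.continuousAt_lyap normSq_extreme hw hyS hT hC hK hO hv) hl₂ hy]
  obtain ⟨y, hy⟩ := hγ.exists_mapClusterPt hw hw' hx
  obtain ⟨b, h0, h1, rfl, hb⟩ := key y hy
  refine ⟨b, h0, h1, hγ.omegaSet_eq_singleton hw hw' hx fun z hz => ?_⟩
  obtain ⟨b', h0', h1', rfl, hb'⟩ := key z hz
  rw [lineInvariant_injOn ⟨h0', h1'⟩ ⟨h0, h1⟩ (by linarith)]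

end Cases

end TiltedBianchiII

theorem theorem1 (w : ℝ) (hw_lower : -1 < w) (hw_upper : w < 1)
    (x : TiltedBianchiII.State) (hx : x ∈ TiltedBianchiII.sGen w) :
    (∃ γ : ℝ → TiltedBianchiII.State, TiltedBianchiII.IsFutureOrbit w x γ) ∧
    ∀ γ : ℝ → TiltedBianchiII.State, TiltedBianchiII.IsFutureOrbit w x γ →
      (∀ τ : ℝ, 0 ≤ τ → γ τ ∈ TiltedBianchiII.sGen w) ∧
      (w ≤ -1 / 3 → TiltedBianchiII.omegaSet γ = {TiltedBianchiII.ptF}) ∧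
      (-1 / 3 < w → w ≤ 3 / 7 →
        TiltedBianchiII.omegaSet γ = {TiltedBianchiII.ptCS w}) ∧
      (3 / 7 < w → w < 5 / 9 →
        TiltedBianchiII.omegaSet γ = {TiltedBianchiII.ptH w}) ∧
      (w = 5 / 9 → ∃ b : ℝ, 0 < b ∧ b < 1 ∧
        TiltedBianchiII.omegaSet γ = {TiltedBianchiII.ptHL b}) ∧
      (5 / 9 < w → TiltedBianchiII.omegaSet γ = {TiltedBianchiII.ptHet}) := by
  refine ⟨TiltedBianchiII.exists_isFutureOrbit hw_lower hw_upper hx, fun γ hγ =>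
    ⟨hγ.mem_sGen hw_lower hw_upper hx, hγ.omegaSet_eq_ptF hw_lower hw_upper hx,
      hγ.omegaSet_eq_ptCS hw_lower hw_upper hx, hγ.omegaSet_eq_ptH hw_lower hw_upper hx, ?_,
      hγ.omegaSet_eq_ptHet hw_lower hw_upper hx⟩⟩
  rintro rfl
  exact hγ.exists_omegaSet_eq_ptHL hx
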